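/- Let $n\ge 2$ be an even number of qubits and $t\ge 1$. For a probability distribution $\nu$ on the unitary group $U(2^n)$ let $$M(\nu,t)=\int U^{\otimes t}\otimes \overline{U}{}^{\otimes t}\,\mathrm d\nu(U)$$ be its $t$-th moment operator, and let $\|\cdot\|_\infty$ denote the Schatten $\infty$-norm (operator norm). Let $\mathcal P_m$ be the $m$-qubit Pauli group and $\mathrm{Cl}(m)=\{U\in U(2^m,\mathbb Q[i]) : U\mathcal P_m U^\dagger\subset\mathcal P_m\}$ the $m$-qubit Clifford group, which is finite modulo global phases; "uniform on $\mathrm{Cl}(m)$" means uniform modulo global phases (these do not affect moment operators). Let $\mu_{\mathrm{Cl}}$ be the uniform distribution on $\mathrm{Cl}(n)$, and let $\nu_n^{\mathrm{Cl,bw}}$ be the distribution of the brickwork circuit in which first $U_{1,2}\otimes U_{3,4}\otimes\cdots\otimes U_{n-1,n}$ and then $U_{2,3}\otimes U_{4,5}\otimes\cdots$ is applied, where the gates $U_{i,i+1}$ are drawn independently and uniformly from $\mathrm{Cl}(2)$; the second layer either ends with $U_{n-2,n-1}$ (open boundary; the layer is empty if $n=2$) or contains in addition a gate $U_{n,1}$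 (periodic boundary). Then, for both boundary conditions, $$\left\|M\left(\nu_n^{\mathrm{Cl,bw}},t\right)-M(\mu_{\mathrm{Cl}},t)\right\|_\infty\le 1-\frac{1}{2000\,n^3}.$$ -/

import Mathlib

open Matrix MeasureTheory

namespace CliffordBrickwork

/-- Computational basis labels of `n` qubits. -/
abbrev Basis (n : ℕ) : Type := Fin n → Fin 2

/-- The unitary group of `(ℂ²)^{⊗ n}`, in the computational basis. -/
noncomputable abbrev UGroup (n : ℕ) : Type := Matrix.unitaryGroup (Basis n) ℂ

noncomputable instance instMeasurableSpaceUGroup (n : ℕ) : MeasurableSpace (UGroup n) := borel _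

instance instBorelSpaceUGroup (n : ℕ) : BorelSpace (UGroup n) := ⟨rfl⟩

/-! ### Moment operators -/

/-- The tensor power `U^{⊗ t}`. -/
noncomputable def tensorPower {ι : Type*} (U : Matrix ι ι ℂ) (t : ℕ) :
    Matrix (Fin t → ι) (Fin t → ι) ℂ :=
  Matrix.of fun a b => ∏ k, U (a k) (b k)

/-- `U^{⊗ t} ⊗ Ū^{⊗ t}`, where `Ū` is the entrywise complex conjugate. -/
noncomputable def momentKernel {ι : Type*} (U : Matrix ι ι ℂ) (t : ℕ) :
    Matrix ((Fin t → ι) × (Fin t → ι)) ((Fin t → ι) × (Fin t → ι)) ℂ :=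
  Matrix.kroneckerMap (· * ·) (tensorPower U t) (tensorPower (U.map star) t)

/-- The `t`-th moment operator `M(ν, t) = ∫ U^{⊗ t} ⊗ Ū^{⊗ t} dν(U)` (entrywise integral). -/
noncomputable def momentOperator {n : ℕ} (ν : Measure (UGroup n)) (t : ℕ) :
    Matrix ((Fin t → Basis n) × (Fin t → Basis n)) ((Fin t → Basis n) × (Fin t → Basis n)) ℂ :=
  Matrix.of fun x y => ∫ U : UGroup n, momentKernel (U : Matrix (Basis n) (Basis n) ℂ) t x y ∂ν

/-- The Schatten `∞`-norm, i.e. the operator norm for the Euclidean norm. -/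
noncomputable def opNorm {ι : Type*} [Fintype ι] [DecidableEq ι] (A : Matrix ι ι ℂ) : ℝ :=
  ‖Matrix.toEuclideanCLM (n := ι) (𝕜 := ℂ) A‖

/-! ### The Pauli group -/

/-- The matrices `1, X, Y, Z`. -/
noncomputable def pauli : Fin 4 → Matrix (Fin 2) (Fin 2) ℂ :=
  ![!![1, 0; 0, 1], !![0, 1; 1, 0], !![0, -Complex.I; Complex.I, 0], !![1, 0; 0, -1]]

/-- The Pauli string `σ_{p 0} ⊗ ⋯ ⊗ σ_{p (n-1)}`. -/
noncomputable def pauliString {n : ℕ} (p : Fin n → Fin 4) : Matrix (Basis n) (Basis n) ℂ :=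
  Matrix.of fun x y => ∏ j, pauli (p j) (x j) (y j)

/-- The `n`-qubit Pauli group: Pauli strings with phases in `{1, i, -1, -i}`. -/
def pauliGroup (n : ℕ) : Set (Matrix (Basis n) (Basis n) ℂ) :=
  {A | ∃ (k : Fin 4) (p : Fin n → Fin 4), A = Complex.I ^ (k : ℕ) • pauliString p}

theorem pauliGroup_finite (n : ℕ) : (pauliGroup n).Finite := by
  have h : pauliGroup n = Set.range
      (fun q : Fin 4 × (Fin n → Fin 4) => Complex.I ^ (q.1 : ℕ) • pauliString q.2) := by
    ext A
    constructor
    · rintro ⟨k, p, rfl⟩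
      exact ⟨(k, p), rfl⟩
    · rintro ⟨⟨k, p⟩, rfl⟩
      exact ⟨k, p, rfl⟩
  rw [h]
  exact Set.finite_range _

/-! ### The Clifford group -/

/-- The field `ℚ[i] ⊆ ℂ`. -/
def gaussianRationals : Subring ℂ where
  carrier := {z | ∃ a b : ℚ, z = a + b * Complex.I}
  mul_mem' := by
    rintro _ _ ⟨a, b, rfl⟩ ⟨c, d, rfl⟩
    refine ⟨a * c - b * d, a * d + b * c, ?_⟩
    push_cast
    linear_combination (b * d : ℂ) * Complex.I_mul_I
  one_mem' := ⟨1, 0, by simp⟩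
  add_mem' := by
    rintro _ _ ⟨a, b, rfl⟩ ⟨c, d, rfl⟩
    exact ⟨a + c, b + d, by push_cast; ring⟩
  zero_mem' := ⟨0, 0, by simp⟩
  neg_mem' := by
    rintro _ ⟨a, b, rfl⟩
    exact ⟨-a, -b, by push_cast; ring⟩

theorem star_mem_gaussianRationals {z : ℂ} (hz : z ∈ gaussianRationals) :
    star z ∈ gaussianRationals := by
  obtain ⟨a, b, rfl⟩ := hz
  exact ⟨a, -b, by simp⟩

/-- The Clifford group `Cl(n)`: the unitaries with entries in `ℚ[i]` that conjugate the Pauli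
group into itself. -/
noncomputable def cliffordGroup (n : ℕ) : Subgroup (UGroup n) where
  carrier := {U | (∀ x y, (U : Matrix (Basis n) (Basis n) ℂ) x y ∈ gaussianRationals) ∧
    ∀ A ∈ pauliGroup n, (U : Matrix (Basis n) (Basis n) ℂ) * A *
      star (U : Matrix (Basis n) (Basis n) ℂ) ∈ pauliGroup n}
  mul_mem' := by
    rintro U V ⟨hU, hU'⟩ ⟨hV, hV'⟩
    refine ⟨fun x y => ?_, fun A hA => ?_⟩
    · rw [Matrix.UnitaryGroup.mul_val, Matrix.mul_apply]
      exact Subring.sum_mem _ fun z _ => Subring.mul_mem _ (hU _ _) (hV _ _)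
    · have := hU' _ (hV' A hA)
      simpa only [Matrix.UnitaryGroup.mul_val, StarMul.star_mul, Matrix.mul_assoc] using this
  one_mem' := by
    refine ⟨fun x y => ?_, fun A hA => by simpa using hA⟩
    rw [Matrix.UnitaryGroup.one_val, Matrix.one_apply]
    split_ifs
    · exact Subring.one_mem _
    · exact Subring.zero_mem _
  inv_mem' := by
    rintro U ⟨hU, hU'⟩
    have h1 : star (U : Matrix (Basis n) (Basis n) ℂ) * (U : Matrix (Basis n) (Basis n) ℂ) = 1 :=
      Matrix.UnitaryGroup.star_mul_self U
    refine ⟨fun x y => ?_, fun A hA => ?_⟩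
    · rw [Matrix.UnitaryGroup.inv_val, Matrix.star_apply]
      exact star_mem_gaussianRationals (hU _ _)
    · have hinj : Set.InjOn (fun A => (U : Matrix (Basis n) (Basis n) ℂ) * A *
          star (U : Matrix (Basis n) (Basis n) ℂ)) (pauliGroup n) := by
        intro B _ C _ hBC
        have h2 := congrArg (fun D => star (U : Matrix (Basis n) (Basis n) ℂ) * D *
          (U : Matrix (Basis n) (Basis n) ℂ)) hBC
        simpa only [← Matrix.mul_assoc, h1, Matrix.one_mul,
          Matrix.mul_assoc _ (star (U : Matrix (Basis n) (Basis n) ℂ)) _, Matrix.mul_one]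
          using h2
      obtain ⟨B, hB, rfl⟩ := Set.surj_on_of_inj_on_of_ncard_le
        (fun A (_ : A ∈ pauliGroup n) => (U : Matrix (Basis n) (Basis n) ℂ) * A *
          star (U : Matrix (Basis n) (Basis n) ℂ)) hU'
        (fun a b ha hb h => hinj ha hb h) le_rfl (ht := pauliGroup_finite n)
          A hA
      have : ((U⁻¹ : UGroup n) : Matrix (Basis n) (Basis n) ℂ) *
          ((U : Matrix (Basis n) (Basis n) ℂ) * B * star (U : Matrix (Basis n) (Basis n) ℂ)) *
          star ((U⁻¹ : UGroup n) : Matrix (Basis n) (Basis n) ℂ) = B := by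
        rw [Matrix.UnitaryGroup.inv_val, star_star]
        simp only [← Matrix.mul_assoc, h1, Matrix.one_mul,
          Matrix.mul_assoc _ (star (U : Matrix (Basis n) (Basis n) ℂ)) _, Matrix.mul_one]
      rwa [this]

/-- The global phases in `Cl(n)`. -/
noncomputable def globalPhases (n : ℕ) : Subgroup (cliffordGroup n) where
  carrier := {U | ∃ c : ℂ, ((U : UGroup n) : Matrix (Basis n) (Basis n) ℂ) = c • 1}
  mul_mem' := by
    rintro U V ⟨c, hc⟩ ⟨d, hd⟩
    exact ⟨c * d, by simp [hc, hd, smul_smul, mul_comm]⟩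
  one_mem' := ⟨1, by simp⟩
  inv_mem' := by
    rintro U ⟨c, hc⟩
    exact ⟨star c, by simp [hc]⟩

/-- The finite group `Cl(n)` modulo global phases. -/
noncomputable abbrev CliffordClass (n : ℕ) : Type := cliffordGroup n ⧸ globalPhases n

/-- A Clifford unitary with the given class. -/
noncomputable def CliffordClass.rep {n : ℕ} (c : CliffordClass n) : UGroup n :=
  (Quotient.out c : cliffordGroup n)

theorem pauliString_sign {n : ℕ} (j : Fin n) (x y : Basis n) :
    pauliString (Function.update 0 j 3) x y =
      if x = y then (if x j = 0 then 1 else -1) else 0 := by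
  have h0 : pauli 0 = 1 := by ext a b; fin_cases a <;> fin_cases b <;> simp [pauli]
  split_ifs with h h'
  · subst h
    simp only [pauliString, Matrix.of_apply]
    rw [Fintype.prod_eq_single j fun k hk => by simp [Function.update_of_ne hk, h0]]
    simp [h', pauli]
  · subst h
    have h1 : x j = 1 := by omega
    simp only [pauliString, Matrix.of_apply]
    rw [Fintype.prod_eq_single j fun k hk => by simp [Function.update_of_ne hk, h0]]
    simp [h1, pauli]
  · obtain ⟨k, hk⟩ := Function.ne_iff.1 h
    simp only [pauliString, Matrix.of_apply]
    refine Finset.prod_eq_zero (Finset.mem_univ k) ?_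
    by_cases hkj : k = j
    · subst hkj
      have hc : (x k = 0 ∧ y k = 1) ∨ (x k = 1 ∧ y k = 0) := by omega
      rcases hc with ⟨h1, h2⟩ | ⟨h1, h2⟩ <;> simp [h1, h2, pauli]
    · simp [Function.update_of_ne hkj, h0, Matrix.one_apply_ne hk]

theorem pauliString_flip {n : ℕ} (x y : Basis n) :
    pauliString (fun j => if x j = y j then 0 else 1) x y = 1 := by
  simp only [pauliString, Matrix.of_apply]
  refine Finset.prod_eq_one fun j _ => ?_
  have hc : (x j = 0 ∨ x j = 1) ∧ (y j = 0 ∨ y j = 1) := by omega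
  rcases hc with ⟨h1 | h1, h2 | h2⟩ <;> simp [h1, h2, pauli]

/-- A matrix commuting with all Pauli strings is scalar. -/
theorem exists_scalar_of_commute {n : ℕ} (W : Matrix (Basis n) (Basis n) ℂ)
    (hW : ∀ p, W * pauliString p = pauliString p * W) : ∃ c : ℂ, W = c • 1 := by
  have hdiag : ∀ x y, x ≠ y → W x y = 0 := by
    intro x y hxy
    obtain ⟨j, hj⟩ := Function.ne_iff.1 hxy
    have h := congrFun (congrFun (hW (Function.update 0 j 3)) x) y
    simp only [Matrix.mul_apply, pauliString_sign, mul_ite, ite_mul, mul_zero, zero_mul,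
      Finset.sum_ite_eq, Finset.sum_ite_eq', Finset.mem_univ, if_true] at h
    have hc : (x j = 0 ∧ y j = 1) ∨ (x j = 1 ∧ y j = 0) := by omega
    rcases hc with ⟨h1, h2⟩ | ⟨h1, h2⟩ <;> simp [h1, h2] at h
    · linear_combination (-1 / 2 : ℂ) * h
    · linear_combination (1 / 2 : ℂ) * h
  refine ⟨W 0 0, ?_⟩
  ext x y
  by_cases hxy : x = y
  · subst hxy
    have h := congrFun (congrFun (hW (fun j => if x j = (0 : Basis n) j then 0 else 1)) x) 0
    rw [Matrix.mul_apply, Matrix.mul_apply,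
      Fintype.sum_eq_single x fun z hz => by rw [hdiag x z hz.symm, zero_mul],
      Fintype.sum_eq_single 0 fun z hz => by rw [hdiag z 0 hz, mul_zero],
      pauliString_flip] at h
    simpa using h
  · simp [hdiag x y hxy, Matrix.one_apply_ne hxy]

instance instFiniteCliffordClass (n : ℕ) : Finite (CliffordClass n) := by
  have hfin : Finite (pauliGroup n) := (pauliGroup_finite n).to_subtype
  have hmem : ∀ (c : CliffordClass n) (p : Fin n → Fin 4),
      (c.rep : Matrix (Basis n) (Basis n) ℂ) * pauliString p *
        star (c.rep : Matrix (Basis n) (Basis n) ℂ) ∈ pauliGroup n := fun c p =>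
    (Quotient.out c : cliffordGroup n).2.2 _ ⟨0, p, by simp⟩
  refine Finite.of_injective
    (fun (c : CliffordClass n) (p : Fin n → Fin 4) => (⟨_, hmem c p⟩ : pauliGroup n)) ?_
  intro c d hcd
  rw [← Quotient.out_equiv_out]
  refine QuotientGroup.leftRel_apply.2 ?_
  have hc : star (c.rep : Matrix (Basis n) (Basis n) ℂ) * (c.rep : Matrix _ _ ℂ) = 1 :=
    Matrix.UnitaryGroup.star_mul_self c.rep
  have hd : star (d.rep : Matrix (Basis n) (Basis n) ℂ) * (d.rep : Matrix _ _ ℂ) = 1 :=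
    Matrix.UnitaryGroup.star_mul_self d.rep
  refine exists_scalar_of_commute
    (star (c.rep : Matrix (Basis n) (Basis n) ℂ) * (d.rep : Matrix (Basis n) (Basis n) ℂ))
    fun p => ?_
  have h : (c.rep : Matrix (Basis n) (Basis n) ℂ) * pauliString p *
      star (c.rep : Matrix (Basis n) (Basis n) ℂ) = (d.rep : Matrix (Basis n) (Basis n) ℂ) *
      pauliString p * star (d.rep : Matrix (Basis n) (Basis n) ℂ) :=
    congrArg Subtype.val (congrFun hcd p)
  calc _ = star (c.rep : Matrix (Basis n) (Basis n) ℂ) *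
        ((d.rep : Matrix (Basis n) (Basis n) ℂ) * pauliString p *
          star (d.rep : Matrix (Basis n) (Basis n) ℂ)) *
        (d.rep : Matrix (Basis n) (Basis n) ℂ) := by
        simp only [Matrix.mul_assoc, hd, Matrix.mul_one]
    _ = _ := by
        rw [← h]
        simp only [← Matrix.mul_assoc, hc, Matrix.one_mul]

noncomputable instance instFintypeCliffordClass (n : ℕ) : Fintype (CliffordClass n) :=
  Fintype.ofFinite _

/-- The kernel `U^{⊗ t} ⊗ Ū^{⊗ t}` does not see global phases. -/
theorem momentKernel_smul {ι : Type*} (U : Matrix ι ι ℂ) (c : ℂ) (hc : c * star c = 1) (t : ℕ) :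
    momentKernel (c • U) t = momentKernel U t := by
  ext ⟨a, a'⟩ ⟨b, b'⟩
  simp only [momentKernel, tensorPower, Matrix.kroneckerMap_apply, Matrix.of_apply,
    Matrix.smul_apply, Matrix.map_apply, smul_eq_mul, star_mul', Finset.prod_mul_distrib,
    Finset.prod_const, Finset.card_univ, Fintype.card_fin]
  have : c ^ t * star c ^ t = 1 := by rw [← mul_pow, hc, one_pow]
  linear_combination (∏ k, U (a k) (b k)) * (∏ k, star (U (a' k) (b' k))) * this

/-- The uniform distribution `μ_Cl` on `Cl(n)` modulo global phases, realised on
representatives; by `momentKernel_smul` its moment operators do not depend on the latter. -/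
noncomputable def uniformClifford (n : ℕ) : Measure (UGroup n) :=
  ((PMF.uniformOfFintype (CliffordClass n)).map CliffordClass.rep).toMeasure

/-! ### Brickwork circuits -/

/-- The matrix `U` acting on the qubits `e 0, e 1` (in this order), and the identity on all
other qubits. -/
noncomputable def gateMatrix {n : ℕ} (e : Fin 2 ↪ Fin n) (U : Matrix (Basis 2) (Basis 2) ℂ) :
    Matrix (Basis n) (Basis n) ℂ :=
  open Classical in
  Matrix.of fun x y => if ∀ k, k ∉ Set.range e → x k = y k then U (x ∘ e) (y ∘ e) else 0

/-- Splitting the labels of the qubits in the range of `e` off the others. -/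
noncomputable def splitBasis {n : ℕ} (e : Fin 2 ↪ Fin n) :
    Basis n ≃ Basis 2 × ({k // k ∉ Set.range e} → Fin 2) :=
  open Classical in
  (Equiv.piEquivPiSubtypeProd (fun k => k ∈ Set.range e) fun _ => Fin 2).trans
    (Equiv.prodCongr ((Equiv.ofInjective e e.injective).arrowCongr (Equiv.refl _)).symm
      (Equiv.refl _))

theorem gateMatrix_eq {n : ℕ} (e : Fin 2 ↪ Fin n) (U : Matrix (Basis 2) (Basis 2) ℂ) :
    gateMatrix e U = (Matrix.kroneckerMap (· * ·) U
      (1 : Matrix ({k // k ∉ Set.range e} → Fin 2) ({k // k ∉ Set.range e} → Fin 2) ℂ)).submatrix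
      (splitBasis e) (splitBasis e) := by
  classical
  ext x y
  have h : (splitBasis e x).2 = (splitBasis e y).2 ↔ ∀ k, k ∉ Set.range e → x k = y k := by
    rw [funext_iff, Subtype.forall]
    rfl
  have h1 : ∀ z, (splitBasis e z).1 = z ∘ e := fun z => rfl
  simp only [gateMatrix, Matrix.of_apply, Matrix.submatrix_apply, Matrix.kroneckerMap_apply,
    Matrix.one_apply, h, h1, mul_ite, mul_one, mul_zero]

theorem gateMatrix_mem {n : ℕ} (e : Fin 2 ↪ Fin n) (U : UGroup 2) :
    gateMatrix e (U : Matrix (Basis 2) (Basis 2) ℂ) ∈ Matrix.unitaryGroup (Basis n) ℂ := by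
  have h : Matrix.kroneckerMap (· * ·) (U : Matrix (Basis 2) (Basis 2) ℂ)
      (1 : Matrix ({k // k ∉ Set.range e} → Fin 2) ({k // k ∉ Set.range e} → Fin 2) ℂ) ∈
      Matrix.unitaryGroup (Basis 2 × ({k // k ∉ Set.range e} → Fin 2)) ℂ :=
    Matrix.kronecker_mem_unitary U.2 (Submonoid.one_mem _)
  rw [gateMatrix_eq, Matrix.mem_unitaryGroup_iff, Matrix.star_eq_conjTranspose,
    Matrix.conjTranspose_submatrix, Matrix.submatrix_mul_equiv, ← Matrix.star_eq_conjTranspose,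
    Matrix.mem_unitaryGroup_iff.1 h, Matrix.submatrix_one_equiv]

/-- A two-qubit gate, applied to the qubits `e 0, e 1`. -/
noncomputable def gate {n : ℕ} (e : Fin 2 ↪ Fin n) (U : UGroup 2) : UGroup n :=
  ⟨gateMatrix e U, gateMatrix_mem e U⟩

/-- The pair of neighbouring qubits `i, i + 1` (modulo `n`). -/
def bond {n : ℕ} (hn : 2 ≤ n) (i : Fin n) : Fin 2 ↪ Fin n where
  toFun := ![i, ⟨(i + 1) % n, Nat.mod_lt _ (by omega)⟩]
  inj' := by
    have h : (i : ℕ) ≠ (i + 1) % n := by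
      have hi := i.2
      rcases Nat.lt_or_ge (i + 1) n with h | h
      · rw [Nat.mod_eq_of_lt h]
        omega
      · have h' : (i : ℕ) + 1 = n := by omega
        rw [h', Nat.mod_self]
        omega
    intro a b hab
    fin_cases a <;> fin_cases b <;> simp_all [Fin.ext_iff]

/-- Boundary conditions of a chain of qubits. -/
inductive Boundary : Type
  | opened
  | periodic

/-- Whether the gate on the qubits `i, i + 1` (modulo `n`) is present; only the gate across the
boundary, `i = n - 1`, depends on the boundary condition. -/
def Boundary.Allows (b : Boundary) {n : ℕ} (i : Fin n) : Prop :=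
  match b with
  | .opened => (i : ℕ) + 1 < n
  | .periodic => True

/-- The product of the gates `U i` on the qubits `i, i + 1` over the sites `i` with `P i`. In a
brickwork layer the gates have disjoint supports, so that their order is irrelevant. -/
noncomputable def layer {n : ℕ} (hn : 2 ≤ n) (P : Fin n → Prop) (U : Fin n → UGroup 2) :
    UGroup n :=
  open Classical in
  (((List.finRange n).filter fun i => P i).map fun i => gate (bond hn i) (U i)).prod

/-- The brickwork circuit with gates `U i` on the qubits `i, i + 1`. Qubits are numbered from `0`:
first the gates on `(0, 1), (2, 3), …` are applied, then those on `(1, 2), (3, 4), …`. -/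
noncomputable def brickworkCircuit {n : ℕ} (hn : 2 ≤ n) (b : Boundary) (U : Fin n → UGroup 2) :
    UGroup n :=
  layer hn (fun i => Odd (i : ℕ) ∧ b.Allows i) U * layer hn (fun i => Even (i : ℕ) ∧ b.Allows i) U

/-- The distribution of the brickwork circuit whose gates are independent and uniform in the
two-qubit Clifford group (modulo global phases). -/
noncomputable def brickworkClifford {n : ℕ} (hn : 2 ≤ n) (b : Boundary) : Measure (UGroup n) :=
  ((PMF.uniformOfFintype (Fin n → CliffordClass 2)).map
    fun c => brickworkCircuit hn b fun i => (c i).rep).toMeasure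

end CliffordBrickwork

/-! On the space where `U^{⊗ t} ⊗ Ū^{⊗ t}` acts, averaging a gate over the two-qubit Clifford group
gives the orthogonal projection `p i` onto the vectors invariant under all Clifford gates on the
bond `i, i + 1`. Independence of the gates turns the moment operator of the circuit into `B * A`,
where `A` and `B` are the products of the `p i` over even and odd bonds. The moment operator of
`μ_Cl` is the projection `P` onto the invariants of the whole Clifford group, and `P` absorbs every
`p i` from both sides. The task is to show that `φ = (B * A - P) v` is strictly shorter than `v`.
Here `P φ = 0` and `φ = B w` with `w = (A - P) v`, a vector that all even `p i` fix.

Two estimates on the defects `‖φ - p i φ‖` are combined. Upper bound (detectability lemma,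
`sum_norm_sub_apply_sq_le`): if `B` hardly shortens `w`, then `φ` is nearly fixed by the even `p i`,
namely `∑ ‖φ - p i φ‖² ≤ 2 (‖w‖² - ‖φ‖²)`. The odd `p i` fix `φ` exactly. Lower bound: a Clifford
unitary is a product of nearest-neighbour gates using each bond at most `8 n` times
(`IsGateLength.le_of_mem`), and a gate on bond `i` moves `φ` by at most `2 ‖φ - p i φ‖`. So every
Clifford unitary moves `φ` by at most `16 n ∑ ‖φ - p i φ‖`. Since the mean of the translates of `φ`
is `P φ = 0`, this also bounds `‖φ‖` (`norm_le_of_mean_apply_eq_zero`).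

Cauchy–Schwarz over the `n / 2` even bonds gives `‖φ‖² ≤ 256 n³ (‖v‖² - ‖φ‖²)`, which is more than
the claim needs (`norm_opened_sub_apply_le`). The periodic circuit has one further projection on the
left, which does not increase norms (`layerProj_odd_periodic_eq_mul`).

The word-length bound is symplectic Gaussian elimination: transvections along Pauli strings on
neighbouring sites bring the images of `Z` and `X` on one qubit after the other back to themselves
(`IsGateLength.exists_extend_commute`). -/

namespace CliffordBrickwork

/-! ### Products of projections -/

section Projections

variable {E : Type*} [NormedAddCommGroup E] [InnerProductSpace ℂ E] [CompleteSpace E]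

theorem norm_sub_apply_sq {p : E →L[ℂ] E} (hp : IsStarProjection p) (v : E) :
    ‖v - p v‖ ^ 2 = ‖v‖ ^ 2 - ‖p v‖ ^ 2 := by
  have h1 : inner ℂ (p v) (v - p v) = 0 := by
    have h2 : ContinuousLinearMap.adjoint p = p := hp.isSelfAdjoint
    have h3 : p (p v) = p v := congrArg (fun q : E →L[ℂ] E => q v) hp.isIdempotentElem
    rw [← ContinuousLinearMap.adjoint_inner_right, h2, map_sub, h3, sub_self, inner_zero_right]
  have h4 := norm_add_sq_eq_norm_sq_add_norm_sq_of_inner_eq_zero (p v) (v - p v) h1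
  rw [add_sub_cancel] at h4
  linarith

theorem norm_apply_le_of_isStarProjection {p : E →L[ℂ] E} (hp : IsStarProjection p) (v : E) :
    ‖p v‖ ≤ ‖v‖ := by
  have := norm_sub_apply_sq hp v
  exact le_of_sq_le_sq (by nlinarith [sq_nonneg ‖v - p v‖]) (norm_nonneg _)

theorem isStarProjection_list_prod {R : Type*} [Semiring R] [StarRing R] (l : List R)
    (h : ∀ p ∈ l, IsStarProjection p) (hc : ∀ p ∈ l, ∀ q ∈ l, Commute p q) :
    IsStarProjection l.prod := by
  induction l with
  | nil => exact IsStarProjection.one R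
  | cons p l ih =>
    rw [List.prod_cons]
    refine (h p (by simp)).mul (ih (fun q hq => h q (by simp [hq]))
      fun q hq r hr => hc q (by simp [hq]) r (by simp [hr])) ?_
    exact Commute.list_prod_right _ _ fun q hq => hc p (by simp) q (by simp [hq])

/-- The detectability lemma for two layers of projections, the first of which fixes `w`. -/
theorem sum_norm_sub_apply_sq_le (m : ℕ) (a o : ℕ → E →L[ℂ] E)
    (ho : ∀ k, IsStarProjection (o k)) (ha : ∀ l < m, IsStarProjection (a l))
    (hoo : ∀ j k, Commute (o j) (o k))
    (hao : ∀ l < m, ∀ k, k ≠ l → k ≠ l + 1 → Commute (a l) (o k))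
    (w : E) (hw : ∀ l < m, a l w = w) :
    ∑ l ∈ Finset.range m, ‖((List.range (m + 1)).map o).prod w -
        a l (((List.range (m + 1)).map o).prod w)‖ ^ 2 ≤
      2 * (‖w‖ ^ 2 - ‖((List.range (m + 1)).map o).prod w‖ ^ 2) := by
  have hprod : ∀ (s : List ℕ), IsStarProjection (s.map o).prod := fun s => by
    refine isStarProjection_list_prod _ ?_ ?_
    · simp only [List.mem_map]
      rintro _ ⟨k, _, rfl⟩
      exact ho k
    · simp only [List.mem_map]
      rintro _ ⟨k, _, rfl⟩ _ ⟨j, _, rfl⟩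
      exact hoo k j
  set B : ℕ → E →L[ℂ] E := fun k => ((List.range k).map o).prod with hB
  have hB1 : ∀ k, B (k + 1) = B k * o k := fun k => by
    simp only [hB, List.range_succ, List.map_append, List.prod_append, List.map_cons,
      List.map_nil, List.prod_cons, List.prod_nil, mul_one]
  have hBo : ∀ k j, Commute (B k) (o j) := fun k j => by
    refine Commute.list_prod_left _ _ ?_
    simp only [List.mem_map]
    rintro _ ⟨i, _, rfl⟩
    exact hoo i j
  -- Put `y = B l w`, `T = o l * o (l + 1)`, and let `R` be the product of the later factors. As `a
  -- l` commutes with `R` and `B l` and fixes `w`, it fixes `R y`. Hence only `R (y - T y)`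
  -- contributes to the defect of `R (T y)`, and `‖y - T y‖² = ‖y‖² - ‖T y‖²`.
  have key : ∀ l < m, ‖B (m + 1) w - a l (B (m + 1) w)‖ ^ 2 ≤
      ‖B l w‖ ^ 2 - ‖B (l + 2) w‖ ^ 2 := by
    intro l hl
    set s : List ℕ := (List.range (m - 1 - l)).map fun j => l + 2 + j with hs
    set R : E →L[ℂ] E := (s.map o).prod with hR
    have hBR : B (m + 1) = B (l + 2) * R := by
      have : m + 1 = (l + 2) + (m - 1 - l) := by omega
      rw [this]
      simp only [hB, hR, hs]
      rw [List.range_add, List.map_append, List.prod_append]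
    have hRa : Commute (a l) R := by
      refine Commute.list_prod_right _ _ ?_
      simp only [hs, List.mem_map]
      rintro _ ⟨_, ⟨j, _, rfl⟩, rfl⟩
      exact hao l hl _ (by omega) (by omega)
    have hBa : Commute (a l) (B l) := by
      refine Commute.list_prod_right _ _ ?_
      simp only [List.mem_map, List.mem_range]
      rintro _ ⟨j, hj, rfl⟩
      exact hao l hl _ (by omega) (by omega)
    have hoR : ∀ j, Commute (o j) R := fun j => by
      refine Commute.list_prod_right _ _ ?_
      simp only [List.mem_map]
      rintro _ ⟨i, _, rfl⟩
      exact hoo j i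
    set T := o l * o (l + 1) with hT
    have hTp : IsStarProjection T := (ho l).mul (ho _) (hoo _ _)
    have hBT : B (l + 2) = T * B l := by
      rw [hB1, hB1, mul_assoc, (((hBo l l).mul_right (hBo l (l + 1))) : Commute (B l) T).eq]
    have hTR : Commute T R := (hoR l).mul_left (hoR (l + 1))
    have hBRc : Commute (B l) R := by
      refine Commute.list_prod_right _ _ ?_
      simp only [List.mem_map]
      rintro _ ⟨i, _, rfl⟩
      exact hBo l i
    set y := B l w with hy
    have h1 : a l (R y) = R y := by
      calc a l (R y) = (a l * R * B l) w := rfl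
        _ = (R * B l * a l) w := by rw [hRa.eq, mul_assoc, hBa.eq, mul_assoc]
        _ = R y := by
          change R (B l (a l w)) = _
          rw [hw l hl]
    have h2 : B (m + 1) w = R (T y) := by
      rw [hBR, hBT, (hTR.mul_left hBRc).eq]
      rfl
    have hle : ‖(1 - a l) (R (y - T y))‖ ≤ ‖y - T y‖ :=
      (norm_apply_le_of_isStarProjection (ha l hl).one_sub _).trans
        (norm_apply_le_of_isStarProjection (hprod s) _)
    have h3 : B (m + 1) w - a l (B (m + 1) w) = -((1 - a l) (R (y - T y))) := by
      rw [h2]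
      simp only [_root_.sub_apply, one_apply_eq_self, map_sub, h1]
      abel
    have h4 : B (l + 2) w = T y := by rw [hBT]; rfl
    rw [h3, norm_neg, h4, ← norm_sub_apply_sq hTp]
    gcongr
  have hmono : ∀ k, ‖B (k + 1) w‖ ^ 2 ≤ ‖B k w‖ ^ 2 := fun k => by
    have : B (k + 1) w = o k (B k w) := by
      rw [hB1, (hBo k k).eq]
      rfl
    rw [this]
    gcongr
    exact norm_apply_le_of_isStarProjection (ho k) _
  have hanti : Antitone fun k => ‖B k w‖ ^ 2 := antitone_nat_of_succ_le hmono
  have hB0 : B 0 w = w := rfl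
  calc ∑ l ∈ Finset.range m, ‖B (m + 1) w - a l (B (m + 1) w)‖ ^ 2
      ≤ ∑ l ∈ Finset.range m, (‖B l w‖ ^ 2 - ‖B (l + 2) w‖ ^ 2) :=
        Finset.sum_le_sum fun l hl => key l (Finset.mem_range.1 hl)
    -- Each defect is bounded by a drop over two consecutive factors. Splitting it into single drops
    -- gives two telescoping sums, hence the factor 2.
    _ = (∑ l ∈ Finset.range m, (‖B l w‖ ^ 2 - ‖B (l + 1) w‖ ^ 2)) +
        ∑ l ∈ Finset.range m, (‖B (l + 1) w‖ ^ 2 - ‖B (l + 1 + 1) w‖ ^ 2) := by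
        rw [← Finset.sum_add_distrib]
        exact Finset.sum_congr rfl fun l _ => by ring
    _ = (‖B 0 w‖ ^ 2 - ‖B m w‖ ^ 2) + (‖B 1 w‖ ^ 2 - ‖B (m + 1) w‖ ^ 2) := by
        rw [Finset.sum_range_sub' (fun l => ‖B l w‖ ^ 2),
          Finset.sum_range_sub' (fun l => ‖B (l + 1) w‖ ^ 2)]
    _ ≤ 2 * (‖w‖ ^ 2 - ‖B (m + 1) w‖ ^ 2) := by
        have h1 := hanti (Nat.zero_le 1)
        have h2 := hanti (Nat.le_succ m)
        simp only [Nat.succ_eq_add_one, hB0] at h1 h2 ⊢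
        linarith

end Projections

/-! ### Averages over finite groups -/

section Averages

variable {E : Type*} [NormedAddCommGroup E] [InnerProductSpace ℂ E] [CompleteSpace E]

/-- The mean of a family of operators. -/
noncomputable def mean {α A : Type*} [Fintype α] [AddCommGroup A] [Module ℂ A] (f : α → A) : A :=
  (Fintype.card α : ℂ)⁻¹ • ∑ x, f x

theorem mean_const {α A : Type*} [Fintype α] [Nonempty α] [AddCommGroup A] [Module ℂ A] (x : A) :
    mean (fun _ : α => x) = x := by
  rw [mean, Finset.sum_const, Finset.card_univ, ← Nat.cast_smul_eq_nsmul ℂ, smul_smul,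
    inv_mul_cancel₀ (by simp [Fintype.card_ne_zero]), one_smul]

theorem mul_mean {α A : Type*} [Fintype α] [Ring A] [Algebra ℂ A] (x : A) (f : α → A) :
    x * mean f = mean fun i => x * f i := by
  rw [mean, mean, mul_smul_comm, Finset.mul_sum]

theorem mean_mul {α A : Type*} [Fintype α] [Ring A] [Algebra ℂ A] (x : A) (f : α → A) :
    mean f * x = mean fun i => f i * x := by
  rw [mean, mean, smul_mul_assoc, Finset.sum_mul]

theorem mean_comp_equiv {α β A : Type*} [Fintype α] [Fintype β] [AddCommGroup A] [Module ℂ A]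
    (e : α ≃ β) (f : β → A) : mean (fun i => f (e i)) = mean f := by
  rw [mean, mean, Fintype.card_congr e, Equiv.sum_comp e f]

theorem commute_mean {α A : Type*} [Fintype α] [Ring A] [Algebra ℂ A] {x : A} {f : α → A}
    (h : ∀ i, Commute x (f i)) : Commute x (mean f) := by
  rw [commute_iff_eq, mul_mean, mean_mul]
  exact congrArg mean (funext fun i => h i)

theorem norm_apply_eq_of_star_eq_inv {H : Type*} [Group H] (ρ : H →* (E →L[ℂ] E))
    (hρ : ∀ g, star (ρ g) = ρ g⁻¹)
    (g : H) (v : E) : ‖ρ g v‖ = ‖v‖ := by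
  have h1 : star (ρ g) * ρ g = 1 := by rw [hρ, ← map_mul, inv_mul_cancel, map_one]
  have h2 : inner ℂ (ρ g v) (ρ g v) = inner ℂ v v := by
    rw [← ContinuousLinearMap.adjoint_inner_right, ← ContinuousLinearMap.star_eq_adjoint]
    exact congrArg (fun q : E →L[ℂ] E => inner ℂ v (q v)) h1
  rw [norm_eq_sqrt_re_inner (𝕜 := ℂ), h2, ← norm_eq_sqrt_re_inner]

variable {H : Type*} [Group H] [Fintype H]

theorem map_mul_mean {A : Type*} [Ring A] [Algebra ℂ A] (ρ : H →* A) (g : H) :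
    ρ g * mean ρ = mean ρ := by
  rw [mul_mean, ← mean_comp_equiv (Equiv.mulLeft g) ρ]
  simp

theorem mean_mul_map {A : Type*} [Ring A] [Algebra ℂ A] (ρ : H →* A) (g : H) :
    mean ρ * ρ g = mean ρ := by
  rw [mean_mul, ← mean_comp_equiv (Equiv.mulRight g) ρ]
  simp

/-- Idempotence is invariance of the mean under translation; self-adjointness is its invariance
under `g ↦ g⁻¹`. -/
theorem isStarProjection_mean {A : Type*} [Ring A] [StarRing A] [Algebra ℂ A] [StarModule ℂ A]
    (ρ : H →* A) (hρ : ∀ g, star (ρ g) = ρ g⁻¹) : IsStarProjection (mean ρ) where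
  isIdempotentElem := by
    rw [IsIdempotentElem, mean_mul]
    simp only [map_mul_mean, mean_const]
  isSelfAdjoint := by
    rw [IsSelfAdjoint]
    conv_rhs => rw [← mean_comp_equiv (Equiv.inv H) ρ]
    simp [mean, star_smul, star_sum, hρ]

/-- `ρ g` fixes the invariant part of `v` and acts isometrically on the remainder. -/
theorem norm_sub_map_apply_le (ρ : H →* (E →L[ℂ] E)) (hρ : ∀ g, star (ρ g) = ρ g⁻¹)
    (g : H) (v : E) : ‖v - ρ g v‖ ≤ 2 * ‖v - mean ρ v‖ := by
  have h1 : ρ g (mean ρ v) = mean ρ v :=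
    congrArg (fun q : E →L[ℂ] E => q v) (map_mul_mean ρ g)
  have h2 : v - ρ g v = (v - mean ρ v) - ρ g (v - mean ρ v) := by
    rw [map_sub, h1]
    abel
  rw [h2, two_mul]
  refine (norm_sub_le _ _).trans ?_
  rw [norm_apply_eq_of_star_eq_inv ρ hρ]

end Averages

/-- When the translates of `v` average to zero, `v` is itself the average of the displacements `v -
ρ g v`. -/
theorem norm_le_of_mean_apply_eq_zero {E H : Type*} [NormedAddCommGroup E]
    [NormedSpace ℂ E] [Group H] [Fintype H] (ρ : H →* (E →L[ℂ] E)) {v : E} (hv : mean ρ v = 0)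
    {r : ℝ} (hr : ∀ g, ‖v - ρ g v‖ ≤ r) : ‖v‖ ≤ r := by
  have hcard : (0 : ℝ) < Fintype.card H := by exact_mod_cast Fintype.card_pos
  have h1 : (Fintype.card H : ℂ) • v = ∑ g, (v - ρ g v) := by
    have h2 : ∑ g, ρ g v = 0 := by
      have : (Fintype.card H : ℂ)⁻¹ • ∑ g, ρ g v = 0 := by
        rw [← hv, mean]
        simp
      exact (smul_eq_zero.1 this).resolve_left (by simp [Fintype.card_ne_zero])
    rw [Finset.sum_sub_distrib, h2, sub_zero, Finset.sum_const, Finset.card_univ,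
      Nat.cast_smul_eq_nsmul]
  have h3 : (Fintype.card H : ℝ) * ‖v‖ ≤ Fintype.card H * r := by
    calc (Fintype.card H : ℝ) * ‖v‖ = ‖∑ g, (v - ρ g v)‖ := by rw [← h1, norm_smul]; simp
      _ ≤ ∑ g : H, r := norm_sum_le_of_le _ fun g _ => hr g
      _ = Fintype.card H * r := by simp
  exact le_of_mul_le_mul_left h3 hcard

/-! ### Means of products of independent factors -/

/-- Resampling one coordinate of a uniform family leaves the family uniform. -/
theorem mean_update {ι C A : Type*} [Fintype ι] [DecidableEq ι] [Fintype C] [AddCommGroup A]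
    [Module ℂ A] (i : ι) (F : (ι → C) → A) :
    mean (fun c => mean fun d => F (Function.update c i d)) = mean F := by
  rcases isEmpty_or_nonempty C with hC | hC
  · have : IsEmpty (ι → C) := ⟨fun c => hC.false (c i)⟩
    simp [mean]
  -- Exchanging the fresh sample with the old coordinate is an involution of the pairs `(c, d)`, so
  -- both double sums agree.
  have hinv : Function.Involutive fun q : (ι → C) × C => (Function.update q.1 i q.2, q.1 i) := by
    rintro ⟨c, d⟩
    simp
  have h1 : ∑ c : ι → C, ∑ d, F (Function.update c i d) = ∑ c : ι → C, ∑ _d : C, F c := by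
    rw [← Fintype.sum_prod_type', ← Fintype.sum_prod_type']
    exact (Equiv.sum_comp hinv.toPerm fun q : (ι → C) × C => F q.1)
  simp only [mean, ← Finset.smul_sum]
  rw [h1]
  congr 1
  simp only [Finset.sum_const, Finset.card_univ, ← Finset.smul_sum]
  rw [← Nat.cast_smul_eq_nsmul ℂ, smul_smul,
    inv_mul_cancel₀ (by simp [Fintype.card_ne_zero]), one_smul]

/-- The mean of a product of independent factors is the product of the means. Without repetitions in
`l`, each coordinate enters only one factor. -/
theorem mean_list_prod {ι C A : Type*} [Fintype ι] [DecidableEq ι] [Fintype C] [Nonempty C]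
    [Ring A] [Algebra ℂ A] (f : ι → C → A) (l : List ι) (hl : l.Nodup) :
    mean (fun c : ι → C => (l.map fun i => f i (c i)).prod) = (l.map fun i => mean (f i)).prod := by
  induction l with
  | nil => simpa using mean_const (α := ι → C) (1 : A)
  | cons i l ih =>
    obtain ⟨hi, hl⟩ := List.nodup_cons.1 hl
    rw [← mean_update i]
    have h1 : ∀ (c : ι → C) (d : C), ((i :: l).map fun j => f j (Function.update c i d j)).prod =
        f i d * (l.map fun j => f j (c j)).prod := fun c d => by
      rw [List.map_cons, List.prod_cons, Function.update_self]
      congr 2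
      refine List.map_congr_left fun j hj => ?_
      rw [Function.update_of_ne]
      rintro rfl
      exact hi hj
    simp only [h1]
    simp only [← mean_mul]
    rw [← mul_mean, ih hl, List.map_cons, List.prod_cons]

/-! ### Tensor products of matrices -/

/-- The tensor product of a finite family of matrices. -/
noncomputable def piTensor {κ ι : Type*} [Fintype κ] (A : κ → Matrix ι ι ℂ) :
    Matrix (κ → ι) (κ → ι) ℂ :=
  Matrix.of fun a b => ∏ k, A k (a k) (b k)

theorem piTensor_mul {κ ι : Type*} [Fintype κ] [DecidableEq κ] [Fintype ι]
    (A B : κ → Matrix ι ι ℂ) : piTensor A * piTensor B = piTensor fun k => A k * B k := by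
  ext a b
  simp only [piTensor, Matrix.mul_apply, Matrix.of_apply, Fintype.prod_sum,
    Finset.prod_mul_distrib]

theorem piTensor_one {κ ι : Type*} [Fintype κ] [DecidableEq ι] :
    piTensor (fun _ : κ => (1 : Matrix ι ι ℂ)) = 1 := by
  classical
  ext a b
  by_cases h : a = b
  · subst h
    simp [piTensor]
  · obtain ⟨k, hk⟩ := Function.ne_iff.1 h
    rw [Matrix.one_apply_ne h]
    exact Finset.prod_eq_zero (Finset.mem_univ k) (Matrix.one_apply_ne hk)

theorem piTensor_conjTranspose {κ ι : Type*} [Fintype κ] (A : κ → Matrix ι ι ℂ) :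
    (piTensor A)ᴴ = piTensor fun k => (A k)ᴴ := by
  ext a b
  simp [piTensor]

theorem piTensor_smul {κ ι : Type*} [Fintype κ] (c : κ → ℂ) (A : κ → Matrix ι ι ℂ) :
    piTensor (fun k => c k • A k) = (∏ k, c k) • piTensor A := by
  ext a b
  simp [piTensor, Finset.prod_mul_distrib]

theorem pauliString_eq_piTensor {n : ℕ} (p : Fin n → Fin 4) :
    pauliString p = piTensor fun j => pauli (p j) := rfl

/-! ### Pauli calculus -/

/-- The exponent of the phase `i` in the product of two Pauli matrices. -/
def pauliPhase : Fin 4 → Fin 4 → ℕ :=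
  ![![0, 0, 0, 0], ![0, 0, 1, 3], ![0, 3, 0, 1], ![0, 1, 3, 0]]

/-- The commutation sign of two Pauli matrices. -/
def pauliSign (a b : Fin 4) : ℤ := if a = 0 ∨ b = 0 ∨ a = b then 1 else -1

theorem pauli_zero : pauli 0 = 1 := by
  ext a b; fin_cases a <;> fin_cases b <;> simp [pauli]

/-- Among the labels `1, 2, 3` of `X, Y, Z`, any two distinct ones have the third as bitwise xor, so
xor of labels is multiplication modulo phases. -/
theorem pauli_mul (a b : Fin 4) :
    pauli a * pauli b = Complex.I ^ pauliPhase a b • pauli (a ^^^ b) := by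
  have h3 : Complex.I ^ 3 = -Complex.I := Complex.I_pow_three
  fin_cases a <;> fin_cases b <;>
    simp only [Fin.zero_eta, Fin.mk_one, Fin.reduceFinMk, Fin.isValue, Fin.reduceXor] <;>
    ext x y <;> fin_cases x <;> fin_cases y <;>
    simp [pauli, pauliPhase, Matrix.mul_apply, h3]

theorem pauli_mul_comm (a b : Fin 4) :
    pauli a * pauli b = (pauliSign a b : ℂ) • (pauli b * pauli a) := by
  fin_cases a <;> fin_cases b <;>
    ext x y <;> fin_cases x <;> fin_cases y <;>
    simp [pauli, pauliSign, Matrix.mul_apply]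

theorem pauli_conjTranspose (a : Fin 4) : (pauli a)ᴴ = pauli a := by
  fin_cases a <;> ext x y <;> fin_cases x <;> fin_cases y <;> simp [pauli]

theorem pauliSign_comm (a b : Fin 4) : pauliSign a b = pauliSign b a := by
  revert a b; decide

theorem pauliSign_mul_self (a b : Fin 4) : pauliSign a b * pauliSign a b = 1 := by
  revert a b; decide

variable {n : ℕ}

/-- The product of two Pauli strings up to phase. -/
def stringXor (p q : Fin n → Fin 4) : Fin n → Fin 4 := fun j => p j ^^^ q j

/-- The commutation sign of two Pauli strings. -/
def stringSign (p q : Fin n → Fin 4) : ℤ := ∏ j, pauliSign (p j) (q j)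

theorem pauliString_zero : pauliString (0 : Fin n → Fin 4) = 1 := by
  simp only [pauliString_eq_piTensor, Pi.zero_apply, pauli_zero, piTensor_one]

theorem pauliString_mul (p q : Fin n → Fin 4) :
    pauliString p * pauliString q =
      Complex.I ^ (∑ j, pauliPhase (p j) (q j)) • pauliString (stringXor p q) := by
  simp only [pauliString_eq_piTensor, piTensor_mul, pauli_mul, piTensor_smul,
    Finset.prod_pow_eq_pow_sum, stringXor]

theorem pauliString_mul_comm (p q : Fin n → Fin 4) :
    pauliString p * pauliString q = (stringSign p q : ℂ) • (pauliString q * pauliString p) := by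
  simp only [pauliString_eq_piTensor, piTensor_mul]
  simp only [pauli_mul_comm (p _) (q _), piTensor_smul, stringSign, Int.cast_prod]

theorem pauliString_mul_self (p : Fin n → Fin 4) : pauliString p * pauliString p = 1 := by
  have h1 : ∀ a : Fin 4, pauliPhase a a = 0 := by decide
  have h2 : stringXor p p = 0 := by
    funext j
    have : ∀ a : Fin 4, a ^^^ a = 0 := by decide
    exact this _
  simp [pauliString_mul, h1, h2, pauliString_zero]

theorem pauliString_conjTranspose (p : Fin n → Fin 4) : (pauliString p)ᴴ = pauliString p := by
  simp only [pauliString_eq_piTensor, piTensor_conjTranspose, pauli_conjTranspose]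

theorem star_pauliString (p : Fin n → Fin 4) : star (pauliString p) = pauliString p :=
  pauliString_conjTranspose p

theorem stringSign_comm (p q : Fin n → Fin 4) : stringSign p q = stringSign q p :=
  Finset.prod_congr rfl fun _ _ => pauliSign_comm _ _

theorem stringSign_eq_or (p q : Fin n → Fin 4) : stringSign p q = 1 ∨ stringSign p q = -1 := by
  refine mul_self_eq_one_iff.1 ?_
  simp only [stringSign, ← Finset.prod_mul_distrib, pauliSign_mul_self, Finset.prod_const_one]

theorem pauliSign_zero_left (a : Fin 4) : pauliSign 0 a = 1 := by simp [pauliSign]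

theorem pauliSign_zero_right (a : Fin 4) : pauliSign a 0 = 1 := by simp [pauliSign]

theorem stringSign_single (p : Fin n → Fin 4) (j : Fin n) (a : Fin 4) :
    stringSign p (Pi.single j a) = pauliSign (p j) a := by
  rw [stringSign, Fintype.prod_eq_single j fun k hk => by
    rw [Pi.single_eq_of_ne hk, pauliSign_zero_right], Pi.single_eq_same]

theorem pauli_mem_gaussianRationals (a : Fin 4) (x y : Fin 2) : pauli a x y ∈ gaussianRationals := by
  have hI : Complex.I ∈ gaussianRationals := ⟨0, 1, by simp⟩
  have h0 := gaussianRationals.zero_mem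
  have h1 := gaussianRationals.one_mem
  have hI' := gaussianRationals.neg_mem hI
  have h1' := gaussianRationals.neg_mem h1
  fin_cases a <;> fin_cases x <;> fin_cases y <;> simp [pauli, *]

theorem pauliString_mem_gaussianRationals (p : Fin n → Fin 4) (x y : Basis n) :
    pauliString p x y ∈ gaussianRationals :=
  Subring.prod_mem (t := Finset.univ) (f := fun j => pauli (p j) (x j) (y j)) _
    fun _ _ => pauli_mem_gaussianRationals _ _ _

theorem smul_pauliString_mem (k : ℕ) (p : Fin n → Fin 4) :
    Complex.I ^ k • pauliString p ∈ pauliGroup n :=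
  ⟨⟨k % 4, Nat.mod_lt _ (by norm_num)⟩, p, by rw [Complex.I_pow_eq_pow_mod]⟩

/-- A Gaussian rational unitary that intertwines Pauli strings is in the Clifford group. -/
theorem mem_cliffordGroup_of_intertwines (U : UGroup n)
    (hU : ∀ x y, (U : Matrix (Basis n) (Basis n) ℂ) x y ∈ gaussianRationals)
    (h : ∀ p, ∃ (k : ℕ) (q : Fin n → Fin 4),
      (U : Matrix (Basis n) (Basis n) ℂ) * pauliString p =
        Complex.I ^ k • (pauliString q * (U : Matrix (Basis n) (Basis n) ℂ))) :
    U ∈ cliffordGroup n := by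
  refine ⟨hU, ?_⟩
  rintro _ ⟨k, p, rfl⟩
  obtain ⟨l, q, hq⟩ := h p
  have h1 : (U : Matrix (Basis n) (Basis n) ℂ) * star (U : Matrix (Basis n) (Basis n) ℂ) = 1 :=
    Matrix.mem_unitaryGroup_iff.1 U.2
  rw [mul_smul_comm, hq, smul_smul, smul_mul_assoc, mul_assoc, h1, mul_one, ← pow_add]
  exact smul_pauliString_mem _ _

theorem exists_intertwines_of_mem {U : UGroup n} (hU : U ∈ cliffordGroup n) (p : Fin n → Fin 4) :
    ∃ (k : ℕ) (q : Fin n → Fin 4), (U : Matrix (Basis n) (Basis n) ℂ) * pauliString p =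
      Complex.I ^ k • (pauliString q * (U : Matrix (Basis n) (Basis n) ℂ)) := by
  obtain ⟨k, q, hq⟩ := hU.2 (pauliString p) ⟨0, p, by simp⟩
  refine ⟨k, q, ?_⟩
  have h1 : star (U : Matrix (Basis n) (Basis n) ℂ) * (U : Matrix (Basis n) (Basis n) ℂ) = 1 :=
    Matrix.mem_unitaryGroup_iff'.1 U.2
  rw [← smul_mul_assoc, ← hq, mul_assoc, h1, mul_one]

/-! ### Pauli strings and transvections as Clifford unitaries -/

/-- The Pauli string `p` as a unitary. -/
noncomputable def pauliUnitary (p : Fin n → Fin 4) : UGroup n :=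
  ⟨pauliString p, by rw [Matrix.mem_unitaryGroup_iff, star_pauliString, pauliString_mul_self]⟩

theorem pauliUnitary_mem (p : Fin n → Fin 4) : pauliUnitary p ∈ cliffordGroup n := by
  refine mem_cliffordGroup_of_intertwines _ (pauliString_mem_gaussianRationals p) fun q => ?_
  change ∃ (k : ℕ) (r : Fin n → Fin 4), pauliString p * pauliString q =
    Complex.I ^ k • (pauliString r * pauliString p)
  rcases stringSign_eq_or p q with h | h
  · exact ⟨0, q, by simp [pauliString_mul_comm p q, h]⟩
  · exact ⟨2, q, by simp [pauliString_mul_comm p q, h]⟩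

/-- The matrix `(1 + i) / 2 * (1 + i σ_u)`, which implements the transvection along `u`. -/
noncomputable def transvectionMatrix (u : Fin n → Fin 4) : Matrix (Basis n) (Basis n) ℂ :=
  ((1 + Complex.I) / 2) • (1 + Complex.I • pauliString u)

theorem transvectionMatrix_mem (u : Fin n → Fin 4) :
    transvectionMatrix u ∈ Matrix.unitaryGroup (Basis n) ℂ := by
  rw [Matrix.mem_unitaryGroup_iff, transvectionMatrix, star_smul, star_add, star_one, star_smul,
    star_pauliString, smul_mul_smul_comm]
  have h1 : (1 + Complex.I • pauliString u) * (1 + star Complex.I • pauliString u) =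
      (2 : ℂ) • 1 := by
    rw [add_mul, mul_add, mul_add, smul_mul_smul_comm, pauliString_mul_self]
    simp only [Complex.star_def, Complex.conj_I, mul_one, one_mul, mul_neg, Complex.I_mul_I,
      neg_neg, one_smul, neg_smul, two_smul]
    abel
  rw [h1, smul_smul]
  -- The prefactor has modulus `1 / √2`, as unitarity requires, and unlike `1 / √2` it lies in
  -- `ℚ[i]`.
  have h2 : (1 + Complex.I) / 2 * star ((1 + Complex.I) / 2) * 2 = 1 := by
    simp only [Complex.star_def, map_div₀, map_add, map_one, Complex.conj_I, map_ofNat]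
    linear_combination (-1 / 2 : ℂ) * Complex.I_mul_I
  rw [h2, one_smul]

/-- The Clifford unitary that implements the transvection along `u`. -/
noncomputable def transvection (u : Fin n → Fin 4) : UGroup n :=
  ⟨transvectionMatrix u, transvectionMatrix_mem u⟩

theorem transvectionMatrix_mul_of_commute {u p : Fin n → Fin 4} (h : stringSign p u = 1) :
    transvectionMatrix u * pauliString p = pauliString p * transvectionMatrix u := by
  have h1 : pauliString p * pauliString u = pauliString u * pauliString p := by
    rw [pauliString_mul_comm, h, Int.cast_one, one_smul]
  simp only [transvectionMatrix, smul_mul_assoc, mul_smul_comm, add_mul, mul_add, one_mul, mul_one,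
    h1]

/-- Up to the common prefactor both sides equal `σ_p + i σ_u σ_p`, because `σ_u σ_p σ_u = -σ_p`.
Thus the transvection multiplies the strings that anticommute with `u` by `u`, up to phase. -/
theorem transvectionMatrix_mul_of_anticommute {u p : Fin n → Fin 4} (h : stringSign p u = -1) :
    transvectionMatrix u * pauliString p =
      Complex.I ^ (1 + ∑ j, pauliPhase (u j) (p j)) •
        (pauliString (stringXor u p) * transvectionMatrix u) := by
  have h1 : pauliString p * pauliString u = -(pauliString u * pauliString p) := by
    rw [pauliString_mul_comm, h, Int.cast_neg, Int.cast_one, neg_smul, one_smul]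
  have h2 : pauliString u * pauliString p * pauliString u = -pauliString p := by
    rw [mul_assoc, h1, mul_neg, ← mul_assoc, pauliString_mul_self, one_mul]
  rw [pow_add, pow_one, mul_smul, ← smul_mul_assoc (Complex.I ^ _), ← pauliString_mul]
  simp only [transvectionMatrix, smul_mul_assoc, mul_smul_comm, add_mul, mul_add, one_mul, mul_one,
    h2]
  rw [smul_comm Complex.I]
  congr 1
  rw [smul_add, smul_smul, Complex.I_mul_I, neg_smul, one_smul, neg_neg, add_comm]

theorem transvection_mem (u : Fin n → Fin 4) : transvection u ∈ cliffordGroup n := by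
  refine mem_cliffordGroup_of_intertwines _ (fun x y => ?_) fun p => ?_
  · have hI : Complex.I ∈ gaussianRationals := ⟨0, 1, by simp⟩
    have h1 : (1 + Complex.I) / 2 ∈ gaussianRationals := ⟨1 / 2, 1 / 2, by push_cast; ring⟩
    change transvectionMatrix u x y ∈ _
    simp only [transvectionMatrix, Matrix.smul_apply, Matrix.add_apply, smul_eq_mul]
    refine Subring.mul_mem _ h1 (Subring.add_mem _ ?_
      (Subring.mul_mem _ hI (pauliString_mem_gaussianRationals _ _ _)))
    rw [Matrix.one_apply]
    split_ifs
    · exact Subring.one_mem _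
    · exact Subring.zero_mem _
  · rcases stringSign_eq_or p u with h | h
    · exact ⟨0, p, by rw [pow_zero, one_smul]; exact transvectionMatrix_mul_of_commute h⟩
    · exact ⟨_, _, transvectionMatrix_mul_of_anticommute h⟩

/-! ### Gates -/

theorem gateMatrix_mul (e : Fin 2 ↪ Fin n) (U V : Matrix (Basis 2) (Basis 2) ℂ) :
    gateMatrix e (U * V) = gateMatrix e U * gateMatrix e V := by
  classical
  rw [gateMatrix_eq, gateMatrix_eq, gateMatrix_eq, Matrix.submatrix_mul_equiv,
    ← Matrix.mul_kronecker_mul, mul_one]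

theorem gateMatrix_one (e : Fin 2 ↪ Fin n) : gateMatrix e 1 = 1 := by
  classical
  rw [gateMatrix_eq, Matrix.one_kronecker_one, Matrix.submatrix_one_equiv]

theorem gateMatrix_smul (e : Fin 2 ↪ Fin n) (c : ℂ) (U : Matrix (Basis 2) (Basis 2) ℂ) :
    gateMatrix e (c • U) = c • gateMatrix e U := by
  ext x y
  simp [gateMatrix]

theorem gateMatrix_add (e : Fin 2 ↪ Fin n) (U V : Matrix (Basis 2) (Basis 2) ℂ) :
    gateMatrix e (U + V) = gateMatrix e U + gateMatrix e V := by
  ext x y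
  simp only [gateMatrix, Matrix.of_apply, Matrix.add_apply]
  split_ifs <;> simp

/-- Placing a two-qubit unitary on two qubits is a homomorphism. -/
noncomputable def gateHom (e : Fin 2 ↪ Fin n) : UGroup 2 →* UGroup n where
  toFun := gate e
  map_one' := Subtype.ext (gateMatrix_one e)
  map_mul' U V := Subtype.ext (gateMatrix_mul e U V)

/-- A matrix that acts trivially on the qubits in the range of `e` commutes with the gates
there. -/
theorem commute_gateMatrix (e : Fin 2 ↪ Fin n) (U : Matrix (Basis 2) (Basis 2) ℂ)
    (N : Matrix (Basis n) (Basis n) ℂ) (h0 : ∀ x y, x ∘ e ≠ y ∘ e → N x y = 0)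
    (h1 : ∀ x y x' y', x ∘ e = y ∘ e → x' ∘ e = y' ∘ e →
      (∀ k, k ∉ Set.range e → x k = x' k ∧ y k = y' k) → N x y = N x' y') :
    Commute (gateMatrix e U) N := by
  classical
  -- `mix x y` agrees with `x` on the qubits of `e` and with `y` elsewhere. In either product, the
  -- gate forces the summation index to agree with one outer index off `e`, and `N` forces it to
  -- agree with the other on `e`. So one term survives: `mix y x` for the first product, `mix x y`
  -- for the second.
  let mix : Basis n → Basis n → Basis n := fun x y k => if k ∈ Set.range e then x k else y k
  have hmix : ∀ x y, mix x y ∘ e = x ∘ e := fun x y =>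
    funext fun a => if_pos ⟨a, rfl⟩
  have hmix' : ∀ x y k, k ∉ Set.range e → mix x y k = y k := fun x y k hk => if_neg hk
  have huniq : ∀ x y z, z ∘ e = x ∘ e → (∀ k, k ∉ Set.range e → z k = y k) → z = mix x y := by
    intro x y z hz hz'
    funext k
    by_cases hk : k ∈ Set.range e
    · obtain ⟨a, rfl⟩ := hk
      rw [← Function.comp_apply (f := z), ← Function.comp_apply (f := mix x y), hz, hmix]
    · rw [hz' k hk, hmix' _ _ _ hk]
  ext x y
  rw [Matrix.mul_apply, Matrix.mul_apply,
    Fintype.sum_eq_single (mix y x), Fintype.sum_eq_single (mix x y)]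
  · have h2 : N (mix y x) y = N x (mix x y) :=
      h1 _ _ _ _ (hmix _ _) (hmix _ _).symm fun k hk => ⟨hmix' _ _ _ hk, (hmix' _ _ _ hk).symm⟩
    have h3 : gateMatrix e U x (mix y x) = U (x ∘ e) (y ∘ e) := by
      simp only [gateMatrix, Matrix.of_apply, hmix]
      exact if_pos fun k hk => (hmix' _ _ _ hk).symm
    have h4 : gateMatrix e U (mix x y) y = U (x ∘ e) (y ∘ e) := by
      simp only [gateMatrix, Matrix.of_apply, hmix]
      exact if_pos fun k hk => hmix' _ _ _ hk
    rw [h2, h3, h4, mul_comm]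
  · intro z hz
    by_cases hzx : x ∘ e = z ∘ e
    · have : gateMatrix e U z y = 0 := by
        simp only [gateMatrix, Matrix.of_apply]
        exact if_neg fun h => hz (huniq x y z hzx.symm h)
      rw [this, mul_zero]
    · rw [h0 x z hzx, zero_mul]
  · intro z hz
    by_cases hzy : z ∘ e = y ∘ e
    · have : gateMatrix e U x z = 0 := by
        simp only [gateMatrix, Matrix.of_apply]
        exact if_neg fun h => hz (huniq y x z hzy fun k hk => (h k hk).symm)
      rw [this, zero_mul]
    · rw [h0 z y hzy, mul_zero]

theorem commute_gateMatrix_pauliString (e : Fin 2 ↪ Fin n) (U : Matrix (Basis 2) (Basis 2) ℂ)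
    (r : Fin n → Fin 4) (hr : ∀ a, r (e a) = 0) : Commute (gateMatrix e U) (pauliString r) := by
  refine commute_gateMatrix e U _ (fun x y h => ?_) fun x y x' y' h h' hk => ?_
  · obtain ⟨a, ha⟩ := Function.ne_iff.1 h
    refine Finset.prod_eq_zero (f := fun k => pauli (r k) (x k) (y k))
      (Finset.mem_univ (e a)) ?_
    rw [hr, pauli_zero]
    exact Matrix.one_apply_ne ha
  · simp only [pauliString, Matrix.of_apply]
    refine Finset.prod_congr rfl fun k _ => ?_
    by_cases hke : k ∈ Set.range e
    · obtain ⟨a, rfl⟩ := hke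
      have ha : x (e a) = y (e a) := congrFun h a
      have ha' : x' (e a) = y' (e a) := congrFun h' a
      rw [hr, pauli_zero, ha, ha', Matrix.one_apply_eq, Matrix.one_apply_eq]
    · rw [(hk k hke).1, (hk k hke).2]

theorem commute_gateMatrix_gateMatrix (e e' : Fin 2 ↪ Fin n) (hee : ∀ a b, e a ≠ e' b)
    (U V : Matrix (Basis 2) (Basis 2) ℂ) : Commute (gateMatrix e U) (gateMatrix e' V) := by
  have hout : ∀ b, e' b ∉ Set.range e := by
    rintro b ⟨a, ha⟩
    exact hee a b ha
  have hout' : ∀ a, e a ∉ Set.range e' := by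
    rintro b ⟨a, ha⟩
    exact hee b a ha.symm
  refine commute_gateMatrix e U _ (fun x y h => ?_) fun x y x' y' h h' hk => ?_
  · obtain ⟨a, ha⟩ := Function.ne_iff.1 h
    simp only [gateMatrix, Matrix.of_apply]
    exact if_neg fun h => ha (h _ (hout' a))
  · have h1 : x ∘ e' = x' ∘ e' := funext fun b => (hk _ (hout b)).1
    have h2 : y ∘ e' = y' ∘ e' := funext fun b => (hk _ (hout b)).2
    simp only [gateMatrix, Matrix.of_apply, h1, h2]
    congr 1
    refine propext (forall_congr' fun k => imp_congr_right fun _ => ?_)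
    by_cases hke : k ∈ Set.range e
    · obtain ⟨a, rfl⟩ := hke
      exact iff_of_true (congrFun h a) (congrFun h' a)
    · rw [(hk k hke).1, (hk k hke).2]

theorem gateMatrix_pauliString (e : Fin 2 ↪ Fin n) (p : Fin n → Fin 4)
    (hp : ∀ k, k ∉ Set.range e → p k = 0) : gateMatrix e (pauliString (p ∘ e)) = pauliString p := by
  ext x y
  simp only [gateMatrix, pauliString, Matrix.of_apply]
  split_ifs with h
  · refine Fintype.prod_of_injective e e.injective _ _ (fun k hk => ?_) fun a => rfl
    rw [hp k hk, pauli_zero, h k hk, Matrix.one_apply_eq]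
  · push Not at h
    obtain ⟨k, hk, hxy⟩ := h
    refine (Finset.prod_eq_zero (f := fun k => pauli (p k) (x k) (y k))
      (Finset.mem_univ k) ?_).symm
    rw [hp k hk, pauli_zero, Matrix.one_apply_ne hxy]

theorem gate_pauliUnitary (e : Fin 2 ↪ Fin n) (p : Fin n → Fin 4)
    (hp : ∀ k, k ∉ Set.range e → p k = 0) : gate e (pauliUnitary (p ∘ e)) = pauliUnitary p :=
  Subtype.ext (gateMatrix_pauliString e p hp)

theorem gate_transvection (e : Fin 2 ↪ Fin n) (u : Fin n → Fin 4)
    (hu : ∀ k, k ∉ Set.range e → u k = 0) : gate e (transvection (u ∘ e)) = transvection u := by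
  refine Subtype.ext ?_
  change gateMatrix e (transvectionMatrix (u ∘ e)) = transvectionMatrix u
  rw [transvectionMatrix, gateMatrix_smul, gateMatrix_add, gateMatrix_one, gateMatrix_smul,
    gateMatrix_pauliString e u hu, transvectionMatrix]

/-- Factor a Pauli string into its part on the qubits of `e` and the rest. The two-qubit Clifford
property handles the former, and the gate commutes with the latter. -/
theorem gate_mem_cliffordGroup (e : Fin 2 ↪ Fin n) {V : UGroup 2} (hV : V ∈ cliffordGroup 2) :
    gate e V ∈ cliffordGroup n := by
  classical
  refine mem_cliffordGroup_of_intertwines _ (fun x y => ?_) fun p => ?_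
  · change gateMatrix e V x y ∈ _
    simp only [gateMatrix, Matrix.of_apply]
    split_ifs
    · exact hV.1 _ _
    · exact Subring.zero_mem _
  · obtain ⟨k, q, hq⟩ := exists_intertwines_of_mem hV (p ∘ e)
    let ext : (Fin 2 → Fin 4) → Fin n → Fin 4 := fun q => Function.extend e q 0
    have hext : ∀ q, ext q ∘ e = q := fun q => Function.extend_comp e.injective _ _
    have hext' : ∀ q, gateMatrix e (pauliString q) = pauliString (ext q) := fun q => by
      conv_lhs => rw [← hext q]
      exact gateMatrix_pauliString e _ fun k hk => Function.extend_apply' _ _ _ hk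
    let r : Fin n → Fin 4 := fun k => if k ∈ Set.range e then 0 else p k
    have hr : ∀ a, r (e a) = 0 := fun a => if_pos ⟨a, rfl⟩
    have hsplit : ∀ j, pauliPhase (ext (p ∘ e) j) (r j) = 0 ∧ stringXor (ext (p ∘ e)) r j = p j := by
      have h1 : ∀ a : Fin 4, a ^^^ 0 = a ∧ 0 ^^^ a = a ∧ pauliPhase a 0 = 0 ∧ pauliPhase 0 a = 0 := by
        decide
      intro j
      by_cases hj : j ∈ Set.range e
      · obtain ⟨a, rfl⟩ := hj
        have h2 : ext (p ∘ e) (e a) = p (e a) := congrFun (hext (p ∘ e)) a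
        simp only [stringXor, hr, h2]
        exact ⟨(h1 _).2.2.1, (h1 _).1⟩
      · have h2 : ext (p ∘ e) j = 0 := Function.extend_apply' _ _ _ hj
        have h3 : r j = p j := if_neg hj
        simp only [stringXor, h2, h3]
        exact ⟨(h1 _).2.2.2, (h1 _).2.1⟩
    have hp : pauliString p = pauliString (ext (p ∘ e)) * pauliString r := by
      rw [pauliString_mul, funext fun j => (hsplit j).2]
      simp only [(hsplit _).1, Finset.sum_const_zero, pow_zero, one_smul]
    refine ⟨k + ∑ j, pauliPhase (ext q j) (r j), stringXor (ext q) r, ?_⟩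
    change gateMatrix e V * pauliString p = _ • (_ * gateMatrix e V)
    have hc := (commute_gateMatrix_pauliString e V r hr).eq
    rw [hp, ← mul_assoc, ← hext', ← gateMatrix_mul, hq, gateMatrix_smul, gateMatrix_mul, hext',
      smul_mul_assoc, mul_assoc, hc, ← mul_assoc, pauliString_mul, smul_mul_assoc, smul_smul,
      ← pow_add]

/-! ### Action of Clifford unitaries on Pauli strings up to phase -/

section Carries

variable {n : ℕ}

/-- Conjugation by `U` maps the Pauli string `p` to a multiple of the Pauli string `q`. -/
def Carries (U : UGroup n) (p q : Fin n → Fin 4) : Prop :=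
  ∃ c : ℂ, (U : Matrix (Basis n) (Basis n) ℂ) * pauliString p =
    c • (pauliString q * (U : Matrix (Basis n) (Basis n) ℂ))

theorem exists_carries {U : UGroup n} (hU : U ∈ cliffordGroup n) (p : Fin n → Fin 4) :
    ∃ q, Carries U p q := by
  obtain ⟨k, q, h⟩ := exists_intertwines_of_mem hU p
  exact ⟨q, _, h⟩

theorem carries_one (p : Fin n → Fin 4) : Carries 1 p p := ⟨1, by simp⟩

theorem carries_of_commute {U : UGroup n} {p : Fin n → Fin 4}
    (h : Commute (U : Matrix (Basis n) (Basis n) ℂ) (pauliString p)) : Carries U p p :=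
  ⟨1, by rw [one_smul]; exact h⟩

theorem Carries.mul {U V : UGroup n} {p q r : Fin n → Fin 4} (hU : Carries U q r)
    (hV : Carries V p q) : Carries (U * V) p r := by
  obtain ⟨c, hc⟩ := hU
  obtain ⟨d, hd⟩ := hV
  refine ⟨d * c, ?_⟩
  rw [Matrix.UnitaryGroup.mul_val, mul_assoc, hd, mul_smul_comm, ← mul_assoc, hc, smul_mul_assoc,
    smul_smul, mul_assoc]

theorem pauliString_mul_ne_zero (U : UGroup n) (p : Fin n → Fin 4) :
    (U : Matrix (Basis n) (Basis n) ℂ) * pauliString p ≠ 0 := by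
  intro h
  have h1 : star (U : Matrix (Basis n) (Basis n) ℂ) * (U : Matrix (Basis n) (Basis n) ℂ) = 1 :=
    Matrix.mem_unitaryGroup_iff'.1 U.2
  have h2 : (1 : Matrix (Basis n) (Basis n) ℂ) = 0 := by
    rw [← pauliString_mul_self p, ← one_mul (pauliString p), ← h1, mul_assoc (star _), h, mul_zero,
      zero_mul]
  exact one_ne_zero h2

/-- Moving `U` past `σ_p σ_q` in either order yields the same scalar, so the commutation sign
survives although phases are forgotten. This is the symplectic invariance of the Clifford action. -/
theorem Carries.stringSign_eq {U : UGroup n} {p p' q q' : Fin n → Fin 4} (hp : Carries U p p')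
    (hq : Carries U q q') : stringSign p q = stringSign p' q' := by
  obtain ⟨c, hc⟩ := hp
  obtain ⟨d, hd⟩ := hq
  set M := (U : Matrix (Basis n) (Basis n) ℂ)
  have h1 : M * (pauliString p * pauliString q) =
      (c * d) • (pauliString p' * pauliString q' * M) := by
    rw [← mul_assoc, hc, smul_mul_assoc, mul_assoc, hd, mul_smul_comm, smul_smul, mul_assoc]
  have h2 : M * (pauliString q * pauliString p) =
      (c * d) • (pauliString q' * pauliString p' * M) := by
    rw [← mul_assoc, hd, smul_mul_assoc, mul_assoc, hc, mul_smul_comm, smul_smul, mul_assoc,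
      mul_comm d]
  have h3 : M * (pauliString p * pauliString q) =
      ((stringSign p q : ℂ) * (stringSign p' q' : ℂ)) • (M * (pauliString p * pauliString q)) := by
    conv_lhs => rw [pauliString_mul_comm, mul_smul_comm, h2, pauliString_mul_comm q' p',
      smul_mul_assoc, smul_comm (c * d), ← h1, smul_smul, stringSign_comm q' p']
  have h4 : M * (pauliString p * pauliString q) ≠ 0 := by
    rw [pauliString_mul, mul_smul_comm]
    exact smul_ne_zero (pow_ne_zero _ Complex.I_ne_zero) (pauliString_mul_ne_zero U _)
  have h5 : (stringSign p q : ℂ) * (stringSign p' q' : ℂ) = 1 := by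
    have h6 : (1 - (stringSign p q : ℂ) * (stringSign p' q' : ℂ)) •
        (M * (pauliString p * pauliString q)) = 0 := by
      rw [sub_smul, one_smul, ← h3, sub_self]
    exact (sub_eq_zero.1 ((smul_eq_zero.1 h6).resolve_right h4)).symm
  have h7 : stringSign p q * stringSign p' q' = 1 := by exact_mod_cast h5
  rcases stringSign_eq_or p q with h | h <;> rcases stringSign_eq_or p' q' with h' | h' <;>
    rw [h, h'] at h7 ⊢ <;> norm_num at h7

/-- A Pauli letter is determined by its commutation signs with the four letters, and these signs are
preserved at a site where `U` commutes with everything. -/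
theorem Carries.apply_eq {U : UGroup n} {p p' : Fin n → Fin 4} (hp : Carries U p p') {j : Fin n}
    (hj : ∀ a, Commute (U : Matrix (Basis n) (Basis n) ℂ) (pauliString (Pi.single j a))) :
    p' j = p j := by
  have h1 : ∀ a, pauliSign (p j) a = pauliSign (p' j) a := fun a => by
    rw [← stringSign_single, ← stringSign_single]
    exact hp.stringSign_eq (carries_of_commute (hj a))
  have h2 : ∀ a b : Fin 4, (∀ c, pauliSign a c = pauliSign b c) → b = a := by decide
  exact h2 _ _ h1

theorem carries_transvection {u p : Fin n → Fin 4} (h : stringSign p u = -1) :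
    Carries (transvection u) p (stringXor u p) :=
  ⟨_, transvectionMatrix_mul_of_anticommute h⟩

theorem commute_transvection {u p : Fin n → Fin 4} (h : stringSign p u = 1) :
    Commute (transvection u : Matrix (Basis n) (Basis n) ℂ) (pauliString p) :=
  transvectionMatrix_mul_of_commute h

/-- The scalar squares to 1 because `σ_p` does. -/
theorem Carries.exists_sign {U : UGroup n} {p : Fin n → Fin 4} (h : Carries U p p) :
    ∃ ε : ℤ, (ε = 1 ∨ ε = -1) ∧ (U : Matrix (Basis n) (Basis n) ℂ) * pauliString p =
      (ε : ℂ) • (pauliString p * (U : Matrix (Basis n) (Basis n) ℂ)) := by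
  obtain ⟨c, hc⟩ := h
  set M := (U : Matrix (Basis n) (Basis n) ℂ)
  have h1 : M * pauliString 0 = (c * c) • (M * pauliString 0) := by
    rw [pauliString_zero, mul_one]
    calc M = M * pauliString p * pauliString p := by
          rw [mul_assoc, pauliString_mul_self, mul_one]
      _ = (c * c) • M := by
          rw [hc, smul_mul_assoc, mul_assoc, hc, mul_smul_comm, ← mul_assoc, pauliString_mul_self,
            one_mul, smul_smul]
  have h2 : (1 - c * c) • (M * pauliString 0) = 0 := by rw [sub_smul, one_smul, ← h1, sub_self]
  have h3 : c * c = 1 :=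
    (sub_eq_zero.1 ((smul_eq_zero.1 h2).resolve_right (pauliString_mul_ne_zero U _))).symm
  rcases mul_self_eq_one_iff.1 h3 with rfl | rfl
  · exact ⟨1, Or.inl rfl, by simpa using hc⟩
  · exact ⟨-1, Or.inr rfl, by simpa using hc⟩

theorem eq_single_of_forall {q : Fin n → Fin 4} {k : Fin n} (h : ∀ j, j ≠ k → q j = 0) :
    q = Pi.single k (q k) := by
  funext j
  by_cases hj : j = k
  · subst hj
    simp
  · rw [h j hj, Pi.single_eq_of_ne hj]

/-- A matrix that commutes with all single-qubit Pauli matrices is scalar. -/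
theorem exists_scalar_of_commute_single (W : Matrix (Basis n) (Basis n) ℂ)
    (hW : ∀ j a, Commute W (pauliString (Pi.single j a))) : ∃ c : ℂ, W = c • 1 := by
  refine exists_scalar_of_commute W fun p => ?_
  -- The string is assembled from its letters one site at a time; disjoint supports produce no
  -- phases.
  suffices h : ∀ s : Finset (Fin n), Commute W (pauliString fun j => if j ∈ s then p j else 0) by
    simpa using (h Finset.univ).eq
  intro s
  induction s using Finset.induction_on with
  | empty => simpa using (pauliString_zero (n := n)) ▸ Commute.one_right W
  | insert i s hi ih =>
    have h1 : ∀ a : Fin 4, a ^^^ 0 = a ∧ 0 ^^^ a = a ∧ pauliPhase a 0 = 0 ∧ pauliPhase 0 a = 0 := by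
      decide
    have h2 : ∀ j, pauliPhase ((Pi.single i (p i) : Fin n → Fin 4) j)
        (if j ∈ s then p j else 0) = 0 ∧
        stringXor (Pi.single i (p i)) (fun j => if j ∈ s then p j else 0) j =
          if j ∈ insert i s then p j else 0 := by
      intro j
      by_cases hj : j = i
      · subst hj
        simp only [stringXor, Pi.single_eq_same, hi, if_false, Finset.mem_insert_self, if_true]
        exact ⟨(h1 _).2.2.1, (h1 _).1⟩
      · simp only [stringXor, Pi.single_eq_of_ne hj, Finset.mem_insert, hj, false_or]
        exact ⟨(h1 _).2.2.2, (h1 _).2.1⟩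
    have h3 := pauliString_mul (Pi.single i (p i)) (fun j => if j ∈ s then p j else 0)
    simp only [(h2 _).1, Finset.sum_const_zero, pow_zero, one_smul, funext fun j => (h2 j).2] at h3
    rw [← h3]
    exact (hW i (p i)).mul_right ih

end Carries

/-! ### Lengths of Clifford circuits on a chain -/

section Length

variable {n : ℕ}

/-- A subadditive length on unitaries for which Clifford gates on the qubits `i, i + 1` have length
at most `w i`. -/
structure IsGateLength (hn : 2 ≤ n) (w : ℕ → ℝ) (ℓ : UGroup n → ℝ) : Prop where
  mul_le : ∀ U V, ℓ (U * V) ≤ ℓ U + ℓ V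
  inv_le : ∀ U, ℓ U⁻¹ ≤ ℓ U
  scalar_le : ∀ U : UGroup n, (∃ c : ℂ, (U : Matrix (Basis n) (Basis n) ℂ) = c • 1) → ℓ U ≤ 0
  gate_le : ∀ i : Fin n, (i : ℕ) + 1 < n → ∀ V ∈ cliffordGroup 2, ℓ (gate (bond hn i) V) ≤ w i
  weight_nonneg : ∀ i, 0 ≤ w i

/-- `C` is a Clifford unitary of length at most `r` that commutes with the Pauli matrices on the
qubits before `k`. -/
structure IsShortFrom (ℓ : UGroup n → ℝ) (k : ℕ) (r : ℝ) (C : UGroup n) : Prop where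
  mem : C ∈ cliffordGroup n
  commute : ∀ j : Fin n, (j : ℕ) < k → ∀ a,
    Commute (C : Matrix (Basis n) (Basis n) ℂ) (pauliString (Pi.single j a))
  le : ℓ C ≤ r

variable {hn : 2 ≤ n} {w : ℕ → ℝ} {ℓ : UGroup n → ℝ}

theorem IsGateLength.one (h : IsGateLength hn w ℓ) (k : ℕ) : IsShortFrom ℓ k 0 (1 : UGroup n) where
  mem := one_mem _
  commute _ _ _ := by
    rw [Matrix.UnitaryGroup.one_val]
    exact Commute.one_left _
  le := h.scalar_le 1 ⟨1, by simp⟩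

theorem IsShortFrom.mul (h : IsGateLength hn w ℓ) {k : ℕ} {r s : ℝ} {C D : UGroup n}
    (hC : IsShortFrom ℓ k r C) (hD : IsShortFrom ℓ k s D) : IsShortFrom ℓ k (r + s) (C * D) where
  mem := mul_mem hC.mem hD.mem
  commute j hj a := by
    rw [Matrix.UnitaryGroup.mul_val]
    exact (hC.commute j hj a).mul_left (hD.commute j hj a)
  le := (h.mul_le C D).trans (add_le_add hC.le hD.le)

theorem IsShortFrom.mono {k k' : ℕ} {r r' : ℝ} {C : UGroup n} (hC : IsShortFrom ℓ k' r C)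
    (hk : k ≤ k') (hr : r ≤ r') : IsShortFrom ℓ k r' C where
  mem := hC.mem
  commute j hj a := hC.commute j (hj.trans_le hk) a
  le := hC.le.trans hr

theorem eq_zero_off_bond {i : Fin n} (hi : (i : ℕ) + 1 < n) {u : Fin n → Fin 4}
    (hu : ∀ j : Fin n, (j : ℕ) ≠ i → (j : ℕ) ≠ i + 1 → u j = 0) :
    ∀ k, k ∉ Set.range (bond hn i) → u k = 0 := by
  intro k hk
  refine hu k (fun h => hk ⟨0, Fin.ext h.symm⟩) fun h => hk ⟨1, Fin.ext ?_⟩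
  change (i + 1 : ℕ) % n = k
  rw [Nat.mod_eq_of_lt hi, h]

theorem commute_single_of_eq_zero {u : Fin n → Fin 4} {j : Fin n} (hu : u j = 0) (a : Fin 4) :
    stringSign (Pi.single j a) u = 1 := by
  rw [stringSign_comm, stringSign_single, hu, pauliSign_zero_left]

theorem IsGateLength.transvection (h : IsGateLength hn w ℓ) {k : ℕ} {i : Fin n}
    (hi : (i : ℕ) + 1 < n) {u : Fin n → Fin 4}
    (hu : ∀ j : Fin n, (j : ℕ) ≠ i → (j : ℕ) ≠ i + 1 → u j = 0)
    (hk : ∀ j : Fin n, (j : ℕ) < k → u j = 0) :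
    IsShortFrom ℓ k (w i) (transvection u) where
  mem := transvection_mem u
  commute j hj a := commute_transvection (commute_single_of_eq_zero (hk j hj) a)
  le := by
    rw [← gate_transvection (bond hn i) u (eq_zero_off_bond hi hu)]
    exact h.gate_le i hi _ (transvection_mem _)

theorem IsGateLength.pauliUnitary (h : IsGateLength hn w ℓ) {k : ℕ} {i : Fin n}
    (hi : (i : ℕ) + 1 < n) {u : Fin n → Fin 4}
    (hu : ∀ j : Fin n, (j : ℕ) ≠ i → (j : ℕ) ≠ i + 1 → u j = 0)
    (hk : ∀ j : Fin n, (j : ℕ) < k → u j = 0) :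
    IsShortFrom ℓ k (w i) (pauliUnitary u) where
  mem := pauliUnitary_mem u
  commute j hj a := by
    have h1 := pauliString_mul_comm u (Pi.single j a)
    rw [stringSign_comm, commute_single_of_eq_zero (hk j hj), Int.cast_one, one_smul] at h1
    exact h1
  le := by
    rw [← gate_pauliUnitary (bond hn i) u (eq_zero_off_bond hi hu)]
    exact h.gate_le i hi _ (pauliUnitary_mem _)

/-- The Pauli string with entries `a, b` at the sites `i, i + 1`. -/
def pairString (n i : ℕ) (a b : Fin 4) : Fin n → Fin 4 := fun j =>
  if (j : ℕ) = i then a else if (j : ℕ) = i + 1 then b else 0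

theorem stringSign_pairString (p : Fin n → Fin 4) (i : ℕ) (hi : i + 1 < n) (a b : Fin 4) :
    stringSign p (pairString n i a b) =
      pauliSign (p ⟨i, by omega⟩) a * pauliSign (p ⟨i + 1, hi⟩) b := by
  rw [stringSign, Fintype.prod_eq_mul ⟨i, by omega⟩ ⟨i + 1, hi⟩
    (fun h => absurd (congrArg Fin.val h) (Nat.ne_of_lt (Nat.lt_succ_self i)))]
  · simp [pairString]
  · rintro j ⟨h1, h2⟩
    have h3 : pairString n i a b j = 0 := by
      rw [pairString, if_neg fun h => h1 (Fin.ext h), if_neg fun h => h2 (Fin.ext h)]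
    rw [h3, pauliSign_zero_right]

theorem pairString_eq_zero {i : ℕ} {a b : Fin 4} {j : Fin n} (h1 : (j : ℕ) ≠ i)
    (h2 : (j : ℕ) ≠ i + 1) : pairString n i a b j = 0 := by
  rw [pairString, if_neg h1, if_neg h2]

theorem IsGateLength.pair (h : IsGateLength hn w ℓ) {k i : ℕ} (hi : i + 1 < n) (hk : k ≤ i)
    (a b : Fin 4) : IsShortFrom ℓ k (w i) (CliffordBrickwork.transvection (pairString n i a b)) :=
  h.transvection (i := ⟨i, by omega⟩) hi (fun _ => pairString_eq_zero)
    fun j hj => pairString_eq_zero (by omega) (by omega)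

theorem exists_pauliSign_eq_neg_one {a : Fin 4} (h : a ≠ 0) : ∃ b, pauliSign a b = -1 := by
  revert a; decide

theorem xor_fin_four (a b : Fin 4) : a ^^^ 0 = a ∧ 0 ^^^ a = a ∧ a ^^^ a = 0 ∧ a ^^^ b ^^^ a = b := by
  revert a b; decide

/-- Two transvections on the qubits `i, i + 1` move the content of site `i + 1` to site `i`. -/
theorem IsGateLength.exists_clear_site (h : IsGateLength hn w ℓ) {k i : ℕ} (hi : i + 1 < n)
    (hk : k ≤ i) (q : Fin n → Fin 4) :
    ∃ C q', IsShortFrom ℓ k (2 * w i) C ∧ Carries C q q' ∧ q' ⟨i + 1, hi⟩ = 0 ∧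
      ∀ j : Fin n, i + 1 < j → q' j = q j := by
  have hw := h.weight_nonneg i
  have hfar : ∀ (a b : Fin 4) (p : Fin n → Fin 4) (j : Fin n), i + 1 < j →
      stringXor (pairString n i a b) p j = p j := by
    intro a b p j hj
    rw [stringXor, pairString_eq_zero (by omega) (by omega)]
    exact (xor_fin_four _ 0).2.1
  have hat : ∀ (a b : Fin 4) (p : Fin n → Fin 4),
      stringXor (pairString n i a b) p ⟨i, by omega⟩ = a ^^^ p ⟨i, by omega⟩ ∧
      stringXor (pairString n i a b) p ⟨i + 1, hi⟩ = b ^^^ p ⟨i + 1, hi⟩ := by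
    intro a b p
    simp [stringXor, pairString]
  by_cases hb : q ⟨i + 1, hi⟩ = 0
  · exact ⟨1, q, (h.one k).mono le_rfl (by positivity), carries_one q, hb, fun _ _ => rfl⟩
  by_cases ha : q ⟨i, by omega⟩ = 0
  -- Site `i` carries the identity, so the first transvection only serves to put an `X` there. The
  -- second one has `Y` at site `i`, which anticommutes with this `X`, and at site `i + 1` the
  -- current letter, which it cancels.
  · obtain ⟨c, hc⟩ := exists_pauliSign_eq_neg_one hb
    set q₁ := stringXor (pairString n i 1 c) q with hq₁
    have h1 : Carries (CliffordBrickwork.transvection (pairString n i 1 c)) q q₁ :=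
      carries_transvection (by
        rw [stringSign_pairString _ _ hi, ha, hc, pauliSign_zero_left, one_mul])
    have h2 : q₁ ⟨i, by omega⟩ = 1 := by
      rw [hq₁, (hat _ _ _).1, ha]; exact (xor_fin_four _ 0).1
    have h3 : Carries (CliffordBrickwork.transvection (pairString n i 2 (q₁ ⟨i + 1, hi⟩))) q₁
        (stringXor (pairString n i 2 (q₁ ⟨i + 1, hi⟩)) q₁) :=
      carries_transvection (by
        rw [stringSign_pairString _ _ hi, h2]
        generalize q₁ ⟨i + 1, hi⟩ = d
        revert d; decide)
    refine ⟨_, _, ((h.pair hi hk _ _).mul h (h.pair hi hk _ _)).mono le_rfl (two_mul _).ge,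
      h3.mul h1, ?_, fun j hj => ?_⟩
    · rw [(hat _ _ _).2]
      exact (xor_fin_four _ 0).2.2.1
    · rw [hfar _ _ _ _ hj, hq₁, hfar _ _ _ _ hj]
  -- The letter at site `i + 1` commutes with itself, so a letter `c` anticommuting at site `i`
  -- makes the whole pair anticommute with `q`. One transvection then cancels site `i + 1`.
  · obtain ⟨c, hc⟩ := exists_pauliSign_eq_neg_one ha
    refine ⟨_, _, (h.pair hi hk c (q ⟨i + 1, hi⟩)).mono le_rfl (by linarith),
      carries_transvection ?_, ?_, fun j hj => hfar _ _ _ _ hj⟩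
    · rw [stringSign_pairString _ _ hi, hc]
      generalize q ⟨i + 1, hi⟩ = d
      revert d; decide
    · rw [(hat _ _ _).2]
      exact (xor_fin_four _ 0).2.2.1

/-- The string is swept from the right end towards site `i`, with at most two gates per bond. `d`
counts the sites to be cleared. -/
theorem IsGateLength.exists_clear_sites (h : IsGateLength hn w ℓ) (d : ℕ) :
    ∀ k i : ℕ, k ≤ i → i + d + 1 = n → ∀ q : Fin n → Fin 4,
    ∃ C q', IsShortFrom ℓ k (2 * ∑ j ∈ Finset.Ico i (n - 1), w j) C ∧ Carries C q q' ∧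
      ∀ j : Fin n, i < j → q' j = 0 := by
  induction d with
  | zero =>
    intro k i _ hi q
    refine ⟨1, q, (h.one k).mono le_rfl ?_, carries_one q, fun j hj => by omega⟩
    have := Finset.sum_nonneg fun j (_ : j ∈ Finset.Ico i (n - 1)) => h.weight_nonneg j
    positivity
  | succ d ih =>
    intro k i hk hi q
    obtain ⟨C, q₁, hC, hq₁, hz⟩ := ih k (i + 1) (by omega) (by omega) q
    obtain ⟨D, q₂, hD, hq₂, hz', hfar⟩ := h.exists_clear_site (k := k) (i := i) (by omega) hk q₁
    refine ⟨D * C, q₂, (hD.mul h hC).mono le_rfl ?_, hq₂.mul hq₁, fun j hj => ?_⟩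
    · rw [Finset.sum_eq_sum_Ico_succ_bot (by omega : i < n - 1)]
      linarith
    · rcases (Nat.succ_le_of_lt hj).eq_or_lt with h1 | h1
      · rw [← hz']
        congr 1
        exact Fin.ext h1.symm
      · rw [hfar j h1, hz j h1]

theorem IsGateLength.weight_le (h : IsGateLength hn w ℓ) {i : ℕ} (hi : i + 1 < n) :
    w i ≤ ∑ j ∈ Finset.range (n - 1), w j :=
  Finset.single_le_sum (fun j _ => h.weight_nonneg j) (Finset.mem_range.2 (by omega))

/-- Clifford unitaries clear the sites of a Pauli string after the site `k`. -/
theorem IsGateLength.exists_clear (h : IsGateLength hn w ℓ) {k : ℕ} (hk : k < n)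
    (q : Fin n → Fin 4) :
    ∃ C q', IsShortFrom ℓ k (2 * ∑ j ∈ Finset.range (n - 1), w j) C ∧ Carries C q q' ∧
      (∀ j : Fin n, (j : ℕ) < k → q' j = q j) ∧ ∀ j : Fin n, k < j → q' j = 0 := by
  obtain ⟨C, q', hC, hq, hz⟩ := h.exists_clear_sites (n - 1 - k) k k le_rfl (by omega) q
  refine ⟨C, q', hC.mono le_rfl ?_, hq, fun j hj => hq.apply_eq (hC.commute j hj), hz⟩
  gcongr
  · exact fun j _ _ => h.weight_nonneg j
  · intro j hj
    rw [Finset.mem_Ico] at hj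
    exact Finset.mem_range.2 hj.2

/-- A single-qubit gate has to be charged to some bond of the open chain. For the last site this is
the bond to its left, which is why later bounds use the sum over all bonds and not only over those
from `k` on. -/
theorem exists_bond_of_site (hn : 2 ≤ n) (k : Fin n) :
    ∃ i : Fin n, (i : ℕ) + 1 < n ∧ ((k : ℕ) = i ∨ (k : ℕ) = i + 1) := by
  by_cases hk : (k : ℕ) + 1 < n
  · exact ⟨k, hk, Or.inl rfl⟩
  · exact ⟨⟨k - 1, by omega⟩, by simp only; omega, Or.inr (by simp only; omega)⟩

theorem single_eq_zero {k j : Fin n} {a : Fin 4} (h : (j : ℕ) ≠ k) :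
    (Pi.single k a : Fin n → Fin 4) j = 0 :=
  Pi.single_eq_of_ne (fun h' => h (congrArg _ h')) _

theorem IsGateLength.transvection_single (h : IsGateLength hn w ℓ) (k : Fin n) (a : Fin 4) :
    IsShortFrom ℓ k (∑ j ∈ Finset.range (n - 1), w j)
      (CliffordBrickwork.transvection (Pi.single k a)) := by
  obtain ⟨i, hi, hk⟩ := exists_bond_of_site hn k
  exact (h.transvection hi (fun j h1 h2 => single_eq_zero (by omega))
    fun j hj => single_eq_zero (by omega)).mono le_rfl (h.weight_le hi)

theorem IsGateLength.pauliUnitary_single (h : IsGateLength hn w ℓ) (k : Fin n) (a : Fin 4) :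
    IsShortFrom ℓ k (∑ j ∈ Finset.range (n - 1), w j)
      (CliffordBrickwork.pauliUnitary (Pi.single k a)) := by
  obtain ⟨i, hi, hk⟩ := exists_bond_of_site hn k
  exact (h.pauliUnitary hi (fun j h1 h2 => single_eq_zero (by omega))
    fun j hj => single_eq_zero (by omega)).mono le_rfl (h.weight_le hi)

theorem stringXor_single (k : Fin n) (a b : Fin 4) :
    stringXor (Pi.single k a) (Pi.single k b) = Pi.single k (a ^^^ b) := by
  funext j
  by_cases hj : j = k
  · subst hj
    simp [stringXor]
  · rw [stringXor, Pi.single_eq_of_ne hj, Pi.single_eq_of_ne hj, Pi.single_eq_of_ne hj]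
    exact (xor_fin_four _ 0).1

/-- A single-qubit transvection maps `a` to `c` and fixes its direction `c ^^^ a`. -/
theorem IsGateLength.exists_carries_single (h : IsGateLength hn w ℓ) (k : Fin n) {a c : Fin 4}
    (ha : a ≠ 0) (hc : c ≠ 0) :
    ∃ C, IsShortFrom ℓ k (∑ j ∈ Finset.range (n - 1), w j) C ∧
      Carries C (Pi.single k a) (Pi.single k c) ∧
      Carries C (Pi.single k (c ^^^ a)) (Pi.single k (c ^^^ a)) := by
  by_cases hac : a = c
  · subst hac
    exact ⟨1, (h.one k).mono le_rfl (Finset.sum_nonneg fun j _ => h.weight_nonneg j),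
      carries_one _, carries_one _⟩
  · refine ⟨_, h.transvection_single k (c ^^^ a), ?_, carries_of_commute (commute_transvection ?_)⟩
    · have h1 : (c ^^^ a) ^^^ a = c := by revert a c; decide
      have h2 := carries_transvection (u := Pi.single k (c ^^^ a)) (p := Pi.single k a) (by
        rw [stringSign_single, Pi.single_eq_same]
        revert a c; decide)
      rwa [stringXor_single, h1] at h2
    · rw [stringSign_single, Pi.single_eq_same]
      generalize c ^^^ a = d
      revert d; decide

theorem carries_apply_eq_zero {U : UGroup n} {k : Fin n}
    (hU : ∀ j : Fin n, (j : ℕ) < k → ∀ a,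
      Commute (U : Matrix (Basis n) (Basis n) ℂ) (pauliString (Pi.single j a)))
    {a : Fin 4} {p : Fin n → Fin 4} (hp : Carries U (Pi.single k a) p) (j : Fin n)
    (hj : (j : ℕ) < k) : p j = 0 := by
  rw [hp.apply_eq (hU j hj), single_eq_zero (by omega)]

theorem stringSign_single_single (k : Fin n) (a b : Fin 4) :
    stringSign (Pi.single k a) (Pi.single k b) = pauliSign a b := by
  rw [stringSign_single, Pi.single_eq_same]

/-- Given that `U` commutes with the Pauli matrices on the qubits before `k`, a short Clifford
circuit extends this to the qubit `k`. -/
theorem IsGateLength.exists_extend_commute (h : IsGateLength hn w ℓ) (k : Fin n) {U : UGroup n}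
    (hmem : U ∈ cliffordGroup n)
    (hU : ∀ j : Fin n, (j : ℕ) < k → ∀ a,
      Commute (U : Matrix (Basis n) (Basis n) ℂ) (pauliString (Pi.single j a))) :
    ∃ C, IsShortFrom ℓ k (8 * ∑ j ∈ Finset.range (n - 1), w j) C ∧
      ∀ a, Commute ((C * U : UGroup n) : Matrix (Basis n) (Basis n) ℂ)
        (pauliString (Pi.single k a)) := by
  -- The budget `8 S` is spent as follows: `3 S` for the image of `Z` (clearing `2 S`, one
  -- single-qubit transvection `S`), `3 S` for clearing the image of `X` (clearing `2 S`, one pair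
  -- transvection `S`), `S` for turning the remaining letter into `X`, and `S` for the Pauli matrix
  -- correcting signs.
  set S := ∑ j ∈ Finset.range (n - 1), w j with hS
  have hS0 : 0 ≤ S := Finset.sum_nonneg fun j _ => h.weight_nonneg j
  have hcomm : ∀ {r : ℝ} {C : UGroup n}, IsShortFrom ℓ k r C → ∀ j : Fin n, (j : ℕ) < k → ∀ a,
      Commute ((C * U : UGroup n) : Matrix (Basis n) (Basis n) ℂ)
        (pauliString (Pi.single j a)) := by
    intro r C hC j hj a
    rw [Matrix.UnitaryGroup.mul_val]
    exact (hC.commute j hj a).mul_left (hU j hj a)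
  -- make the image of `Z` at the site `k` a multiple of itself
  obtain ⟨C₁, hC₁, hZ₁⟩ : ∃ C, IsShortFrom ℓ k (3 * S) C ∧
      Carries (C * U) (Pi.single k 3) (Pi.single k 3) := by
    obtain ⟨p, hp⟩ := exists_carries hmem (Pi.single k 3)
    obtain ⟨C, p', hC, hp', -, hz⟩ := h.exists_clear k.2 p
    have h1 := hp'.mul hp
    have h2 : p' = Pi.single k (p' k) := eq_single_of_forall fun j hj => by
      rcases lt_or_gt_of_ne fun h' => hj (Fin.ext h') with h3 | h3
      · exact carries_apply_eq_zero (hcomm hC) h1 j h3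
      · exact hz j h3
    -- A trivial image of `Z` would commute with the image of `X`, whereas `Z` and `X` anticommute.
    have h3 : p' k ≠ 0 := by
      intro h3
      obtain ⟨q, hq⟩ := exists_carries (mul_mem hC.mem hmem) (Pi.single k 1)
      have h4 := h1.stringSign_eq hq
      rw [h2, h3, stringSign_single_single, stringSign_comm, stringSign_single,
        pauliSign_zero_right] at h4
      exact absurd h4 (by decide)
    obtain ⟨D, hD, hD', -⟩ := h.exists_carries_single k h3 (show (3 : Fin 4) ≠ 0 by decide)
    rw [← h2] at hD'
    exact ⟨D * C, (hD.mul h hC).mono le_rfl (by linarith), by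
      rw [mul_assoc]; exact hD'.mul h1⟩
  obtain ⟨q, hq⟩ := exists_carries (mul_mem hC₁.mem hmem) (Pi.single k 1)
  have hq0 := carries_apply_eq_zero (hcomm hC₁) hq
  have hqk : pauliSign (q k) 3 = -1 := by
    rw [← stringSign_single, stringSign_comm, ← hZ₁.stringSign_eq hq, stringSign_single_single]
    decide
  -- clear the sites after `k` in the image of `X`
  obtain ⟨C₂, c, hC₂, hZ₂, hX₂⟩ : ∃ C c, IsShortFrom ℓ k (3 * S) C ∧
      Carries C (Pi.single k 3) (Pi.single k 3) ∧ Carries C q (Pi.single k c) := by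
    by_cases hk : (k : ℕ) + 1 < n
    -- Clearing starts at `k + 1`, so it commutes with `Z` at the site `k` and does not undo the
    -- first stage. It leaves a possible letter at `k + 1`.
    · obtain ⟨C, q', hC, hq', hsame, hz⟩ := h.exists_clear hk q
      have hZ : Carries C (Pi.single k 3) (Pi.single k 3) :=
        carries_of_commute (hC.commute k (Nat.lt_succ_self _) 3)
      have hk' : q' k = q k := hsame k (Nat.lt_succ_self _)
      by_cases hb : q' ⟨k + 1, hk⟩ = 0
      · have h2 : q' = Pi.single k (q' k) := eq_single_of_forall fun j hj => by
          rcases lt_or_gt_of_ne fun h' => hj (Fin.ext h') with h3 | h3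
          · rw [hsame j (by omega), hq0 j h3]
          · rcases (Nat.succ_le_of_lt h3).eq_or_lt with h4 | h4
            · rw [← hb]
              congr 1
              exact Fin.ext h4.symm
            · exact hz j h4
        exact ⟨C, q' k, hC.mono (Nat.le_succ _) (by linarith), hZ, h2 ▸ hq'⟩
      -- With `Z` at site `k`, `u` commutes with `Z` there, yet anticommutes with `q'`, whose letter
      -- at `k` anticommutes with `Z`. Its letter at `k + 1` cancels that of `q'`.
      · set u := pairString n k 3 (q' ⟨k + 1, hk⟩) with hu
        have h1 : Carries (CliffordBrickwork.transvection u) q' (stringXor u q') :=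
          carries_transvection (by
            rw [hu, stringSign_pairString _ _ hk]
            change pauliSign (q' k) 3 * _ = _
            rw [hk', hqk]
            generalize q' ⟨k + 1, hk⟩ = d
            revert d; decide)
        have h2 : Carries (CliffordBrickwork.transvection u) (Pi.single k 3) (Pi.single k 3) :=
          carries_of_commute (commute_transvection (by
            rw [stringSign_comm, stringSign_single, hu, pairString, if_pos rfl]
            decide))
        have h3 : stringXor u q' = Pi.single k (stringXor u q' k) :=
          eq_single_of_forall fun j hj => by
            have hj' : (j : ℕ) ≠ k := fun h' => hj (Fin.ext h')
            by_cases h4 : (j : ℕ) = k + 1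
            · have h5 : j = ⟨k + 1, hk⟩ := Fin.ext h4
              rw [stringXor, hu, pairString, if_neg hj', if_pos h4, h5]
              exact (xor_fin_four _ 0).2.2.1
            · rw [stringXor, hu, pairString_eq_zero hj' h4]
              have h6 : q' j = 0 := by
                rcases lt_or_gt_of_ne hj' with h3 | h3
                · rw [hsame j (by omega), hq0 j h3]
                · exact hz j (by omega)
              rw [h6]
              exact (xor_fin_four _ 0).1
        have h7 := h.weight_le hk
        exact ⟨_, _, ((h.pair hk le_rfl _ _).mul h (hC.mono (Nat.le_succ _) le_rfl)).mono le_rfl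
          (by linarith), h2.mul hZ, h3 ▸ h1.mul hq'⟩
    · have h2 : q = Pi.single k (q k) := eq_single_of_forall fun j hj =>
        hq0 j (by have := fun h' => hj (Fin.ext h'); omega)
      exact ⟨1, q k, (h.one k).mono le_rfl (by positivity), carries_one _, h2 ▸ carries_one q⟩
  have hck : pauliSign c 3 = -1 := by
    rw [← stringSign_single_single k, stringSign_comm, ← hZ₂.stringSign_eq hX₂, stringSign_comm,
      stringSign_single, hqk]
  obtain ⟨C₃, hC₃, hZ₃, hX₃⟩ : ∃ C, IsShortFrom ℓ k S C ∧
      Carries C (Pi.single k 3) (Pi.single k 3) ∧ Carries C (Pi.single k c) (Pi.single k 1) := by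
    -- The letter anticommutes with `Z`, so it is `X` or `Y`. The transvection taking `Y` to `X` has
    -- direction `1 ^^^ 2 = 3`, that is `Z`, and hence fixes `Z`.
    have hc : c = 1 ∨ c = 2 := by
      clear hX₂
      revert c
      decide
    rcases hc with rfl | rfl
    · exact ⟨1, (h.one k).mono le_rfl hS0, carries_one _, carries_one _⟩
    · obtain ⟨C, hC, h1, h2⟩ := h.exists_carries_single k (show (2 : Fin 4) ≠ 0 by decide)
        (show (1 : Fin 4) ≠ 0 by decide)
      exact ⟨C, hC, h2, h1⟩
  set D := C₃ * (C₂ * C₁) with hD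
  have hDshort : IsShortFrom ℓ k (S + (3 * S + 3 * S)) D := hC₃.mul h (hC₂.mul h hC₁)
  have hZ : Carries (D * U) (Pi.single k 3) (Pi.single k 3) := by
    rw [hD, mul_assoc, mul_assoc]
    exact hZ₃.mul (hZ₂.mul hZ₁)
  have hX : Carries (D * U) (Pi.single k 1) (Pi.single k 1) := by
    rw [hD, mul_assoc, mul_assoc]
    exact hX₃.mul (hX₂.mul hq)
  -- correct the signs by a Pauli matrix
  obtain ⟨ε, hε, hεZ⟩ := hZ.exists_sign
  obtain ⟨δ, hδ, hδX⟩ := hX.exists_sign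
  -- The four Pauli matrices realise all four pairs of commutation signs with `Z` and `X`.
  obtain ⟨a, ha3, ha1⟩ : ∃ a : Fin 4, pauliSign a 3 = ε ∧ pauliSign a 1 = δ := by
    rcases hε with rfl | rfl <;> rcases hδ with rfl | rfl <;> decide
  have hfix : ∀ (b : Fin 4) (η : ℤ), (η = 1 ∨ η = -1) → pauliSign a b = η →
      ((D * U : UGroup n) : Matrix (Basis n) (Basis n) ℂ) * pauliString (Pi.single k b) =
        (η : ℂ) • (pauliString (Pi.single k b) *
          ((D * U : UGroup n) : Matrix (Basis n) (Basis n) ℂ)) →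
      Commute ((CliffordBrickwork.pauliUnitary (Pi.single k a) * D * U : UGroup n) :
        Matrix (Basis n) (Basis n) ℂ) (pauliString (Pi.single k b)) := by
    intro b η hη hab hb
    rw [mul_assoc, Matrix.UnitaryGroup.mul_val, commute_iff_eq, mul_assoc, hb, mul_smul_comm,
      ← mul_assoc]
    change (η : ℂ) • (pauliString (Pi.single k a) * pauliString (Pi.single k b) * _) =
      _ * (pauliString (Pi.single k a) * _)
    rw [pauliString_mul_comm, stringSign_single_single, hab, smul_mul_assoc, smul_smul, mul_assoc]
    rcases hη with rfl | rfl <;> simp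
  have hfixZ := hfix 3 ε hε ha3 hεZ
  have hfixX := hfix 1 δ hδ ha1 hδX
  refine ⟨_, ((h.pauliUnitary_single k a).mul h hDshort).mono le_rfl (by linarith), fun b => ?_⟩
  have hcases : b = 0 ∨ b = 1 ∨ b = 2 ∨ b = 3 := by revert b; decide
  rcases hcases with rfl | rfl | rfl | rfl
  · rw [Pi.single_zero, pauliString_zero]
    exact Commute.one_right _
  · exact hfixX
  -- `Y` is a multiple of `X Z`.
  · have h1 := hfixX.mul_right hfixZ
    rw [pauliString_mul, stringXor_single] at h1
    have h2 := h1.smul_right (Complex.I ^ ∑ j, pauliPhase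
      ((Pi.single k 1 : Fin n → Fin 4) j) ((Pi.single k 3 : Fin n → Fin 4) j))⁻¹
    rwa [smul_smul, inv_mul_cancel₀ (pow_ne_zero _ Complex.I_ne_zero), one_smul] at h2
  · exact hfixZ

/-- Every Clifford unitary is a product of nearest-neighbour gates that uses each pair of
neighbouring qubits at most `8 n` times. -/
theorem IsGateLength.le_of_mem (h : IsGateLength hn w ℓ) {U : UGroup n}
    (hU : U ∈ cliffordGroup n) : ℓ U ≤ 8 * n * ∑ j ∈ Finset.range (n - 1), w j := by
  -- `d` is the number of qubits whose Pauli matrices are not yet known to commute with `U`. Each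
  -- costs one application of `IsGateLength.exists_extend_commute`, and for `d = 0` the unitary is
  -- scalar and has length at most 0.
  suffices H : ∀ d k : ℕ, k + d = n → ∀ U ∈ cliffordGroup n,
      (∀ j : Fin n, (j : ℕ) < k → ∀ a,
        Commute (U : Matrix (Basis n) (Basis n) ℂ) (pauliString (Pi.single j a))) →
      ℓ U ≤ 8 * d * ∑ j ∈ Finset.range (n - 1), w j from
    H n 0 (zero_add n) U hU fun j hj => absurd hj (Nat.not_lt_zero _)
  intro d
  induction d with
  | zero =>
    intro k hk U _ hUk
    have := h.scalar_le U (exists_scalar_of_commute_single _ fun j a => hUk j (by omega) a)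
    simpa using this
  | succ d ih =>
    intro k hk U hU hUk
    obtain ⟨C, hC, hCU⟩ := h.exists_extend_commute ⟨k, by omega⟩ hU hUk
    have h1 := ih (k + 1) (by omega) (C * U) (mul_mem hC.mem hU) fun j hj a => by
      rcases (Nat.lt_succ_iff.1 hj).eq_or_lt with h2 | h2
      · have h3 : j = ⟨k, by omega⟩ := Fin.ext h2
        rw [h3]
        exact hCU a
      · rw [Matrix.UnitaryGroup.mul_val]
        exact (hC.commute j h2 a).mul_left (hUk j h2 a)
    have h2 : ℓ U ≤ ℓ C + ℓ (C * U) := by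
      calc ℓ U = ℓ (C⁻¹ * (C * U)) := by rw [inv_mul_cancel_left]
        _ ≤ ℓ C⁻¹ + ℓ (C * U) := h.mul_le _ _
        _ ≤ _ := by gcongr; exact h.inv_le C
    have h3 := hC.le
    push_cast
    linarith

end Length

/-! ### Moment operators as averages of a unitary representation -/

section Representation

variable {n : ℕ}

theorem tensorPower_eq_piTensor {ι : Type*} (U : Matrix ι ι ℂ) (t : ℕ) :
    tensorPower U t = piTensor fun _ : Fin t => U := rfl

theorem momentKernel_mul {ι : Type*} [Fintype ι] (U V : Matrix ι ι ℂ) (t : ℕ) :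
    momentKernel (U * V) t = momentKernel U t * momentKernel V t := by
  have h : (U * V).map star = U.map star * V.map star := by
    ext a b
    simp [Matrix.mul_apply]
  simp only [momentKernel, tensorPower_eq_piTensor, h, ← piTensor_mul]
  rw [Matrix.mul_kronecker_mul]

theorem momentKernel_one {ι : Type*} [Fintype ι] [DecidableEq ι] (t : ℕ) :
    momentKernel (1 : Matrix ι ι ℂ) t = 1 := by
  have h : (1 : Matrix ι ι ℂ).map star = 1 := by
    ext a b
    by_cases hab : a = b <;> simp [Matrix.one_apply, hab]
  simp only [momentKernel, tensorPower_eq_piTensor, h, piTensor_one]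
  exact Matrix.one_kronecker_one

theorem star_momentKernel {ι : Type*} [Fintype ι] (U : Matrix ι ι ℂ) (t : ℕ) :
    star (momentKernel U t) = momentKernel (star U) t := by
  ext ⟨a, a'⟩ ⟨b, b'⟩
  simp [momentKernel, tensorPower, Matrix.star_apply]

/-- The space on which `t`-th moment operators act. -/
abbrev MomentSpace (n t : ℕ) : Type :=
  EuclideanSpace ℂ ((Fin t → Basis n) × (Fin t → Basis n))

/-- The representation `U ↦ U^{⊗ t} ⊗ Ū^{⊗ t}`. -/
noncomputable def momentRep (n t : ℕ) :
    UGroup n →* (MomentSpace n t →L[ℂ] MomentSpace n t) where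
  toFun U := Matrix.toEuclideanCLM (𝕜 := ℂ) (momentKernel (U : Matrix (Basis n) (Basis n) ℂ) t)
  map_one' := by rw [Matrix.UnitaryGroup.one_val, momentKernel_one, map_one]
  map_mul' U V := by rw [Matrix.UnitaryGroup.mul_val, momentKernel_mul, map_mul]

theorem star_momentRep (t : ℕ) (U : UGroup n) : star (momentRep n t U) = momentRep n t U⁻¹ := by
  change star (Matrix.toEuclideanCLM (𝕜 := ℂ) _) = Matrix.toEuclideanCLM (𝕜 := ℂ) _
  rw [← map_star, star_momentKernel, Matrix.UnitaryGroup.inv_val]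

theorem momentRep_eq_one (t : ℕ) (U : UGroup n)
    (hU : ∃ c : ℂ, (U : Matrix (Basis n) (Basis n) ℂ) = c • 1) : momentRep n t U = 1 := by
  obtain ⟨c, hc⟩ := hU
  have h1 : (U : Matrix (Basis n) (Basis n) ℂ) * star (U : Matrix (Basis n) (Basis n) ℂ) = 1 :=
    Matrix.mem_unitaryGroup_iff.1 U.2
  have h2 : c * star c = 1 := by
    rw [hc, star_smul, star_one, smul_mul_smul_comm, one_mul] at h1
    simpa using congrFun (congrFun h1 0) 0
  change Matrix.toEuclideanCLM (𝕜 := ℂ) (momentKernel (U : Matrix (Basis n) (Basis n) ℂ) t) = 1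
  rw [hc, momentKernel_smul _ _ h2, momentKernel_one, map_one]

instance globalPhases_normal (n : ℕ) : (globalPhases n).Normal where
  conj_mem := by
    rintro U ⟨c, hc⟩ V
    refine ⟨c, ?_⟩
    have h1 : (V : Matrix (Basis n) (Basis n) ℂ) * star (V : Matrix (Basis n) (Basis n) ℂ) = 1 :=
      Matrix.mem_unitaryGroup_iff.1 (V : UGroup n).2
    simp [hc, h1]

/-- A homomorphism on unitaries that ignores global phases, on Clifford classes. -/
noncomputable def cliffordLift {A : Type*} [Monoid A] (f : UGroup n →* A)
    (hf : ∀ U : UGroup n, (∃ c : ℂ, (U : Matrix (Basis n) (Basis n) ℂ) = c • 1) → f U = 1) :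
    CliffordClass n →* A :=
  QuotientGroup.lift (globalPhases n) (f.comp (cliffordGroup n).subtype) fun U hU => hf U hU

variable {A : Type*} [Monoid A] (f : UGroup n →* A)
    (hf : ∀ U : UGroup n, (∃ c : ℂ, (U : Matrix (Basis n) (Basis n) ℂ) = c • 1) → f U = 1)

theorem cliffordLift_mk {U : UGroup n} (hU : U ∈ cliffordGroup n) :
    cliffordLift f hf ((⟨U, hU⟩ : cliffordGroup n) : CliffordClass n) = f U := rfl

theorem cliffordLift_apply (c : CliffordClass n) : cliffordLift f hf c = f c.rep := by
  conv_lhs => rw [← QuotientGroup.out_eq' c]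
  rfl

theorem rep_mem (c : CliffordClass n) : c.rep ∈ cliffordGroup n :=
  (Quotient.out c : cliffordGroup n).2

theorem star_cliffordLift {A : Type*} [Monoid A] [Star A] (f : UGroup n →* A)
    (hf : ∀ U : UGroup n, (∃ c : ℂ, (U : Matrix (Basis n) (Basis n) ℂ) = c • 1) → f U = 1)
    (hs : ∀ U, star (f U) = f U⁻¹) (c : CliffordClass n) :
    star (cliffordLift f hf c) = cliffordLift f hf c⁻¹ := by
  obtain ⟨U, rfl⟩ := QuotientGroup.mk_surjective c
  exact hs U

theorem gateHom_scalar (e : Fin 2 ↪ Fin n) (U : UGroup 2)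
    (hU : ∃ c : ℂ, (U : Matrix (Basis 2) (Basis 2) ℂ) = c • 1) :
    ∃ c : ℂ, (gateHom e U : Matrix (Basis n) (Basis n) ℂ) = c • 1 := by
  obtain ⟨c, hc⟩ := hU
  refine ⟨c, ?_⟩
  change gateMatrix e U = _
  rw [hc, gateMatrix_smul, gateMatrix_one]

/-- The moment representation of the Clifford group modulo phases. -/
noncomputable def cliffordRep (n t : ℕ) :
    CliffordClass n →* (MomentSpace n t →L[ℂ] MomentSpace n t) :=
  cliffordLift (momentRep n t) (momentRep_eq_one t)

/-- The moment representation of the two-qubit Clifford group modulo phases, acting on the qubits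
`e 0, e 1`. -/
noncomputable def gateRep (t : ℕ) (e : Fin 2 ↪ Fin n) :
    CliffordClass 2 →* (MomentSpace n t →L[ℂ] MomentSpace n t) :=
  cliffordLift ((momentRep n t).comp (gateHom e))
    fun U hU => momentRep_eq_one t _ (gateHom_scalar e U hU)

theorem gateRep_apply (t : ℕ) (e : Fin 2 ↪ Fin n) (c : CliffordClass 2) :
    gateRep t e c = momentRep n t (gate e c.rep) :=
  cliffordLift_apply _ _ c

theorem star_cliffordRep (t : ℕ) (c : CliffordClass n) :
    star (cliffordRep n t c) = cliffordRep n t c⁻¹ :=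
  star_cliffordLift _ _ (star_momentRep t) c

theorem star_gateRep (t : ℕ) (e : Fin 2 ↪ Fin n) (c : CliffordClass 2) :
    star (gateRep t e c) = gateRep t e c⁻¹ := by
  refine star_cliffordLift _ _ (fun U => ?_) c
  rw [MonoidHom.comp_apply, star_momentRep, MonoidHom.comp_apply, map_inv (gateHom e)]

theorem exists_cliffordRep_eq (t : ℕ) {U : UGroup n} (hU : U ∈ cliffordGroup n) :
    ∃ c, cliffordRep n t c = momentRep n t U := ⟨_, cliffordLift_mk _ _ hU⟩

/-- The projection onto the invariants of the Clifford group. -/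
noncomputable def cliffordProj (n t : ℕ) : MomentSpace n t →L[ℂ] MomentSpace n t :=
  mean (cliffordRep n t)

/-- The projection onto the invariants of the Clifford group on the qubits `e 0, e 1`. -/
noncomputable def gateProj (t : ℕ) (e : Fin 2 ↪ Fin n) : MomentSpace n t →L[ℂ] MomentSpace n t :=
  mean (gateRep t e)

theorem isStarProjection_cliffordProj (n t : ℕ) : IsStarProjection (cliffordProj n t) :=
  isStarProjection_mean _ (star_cliffordRep t)

theorem isStarProjection_gateProj (t : ℕ) (e : Fin 2 ↪ Fin n) : IsStarProjection (gateProj t e) :=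
  isStarProjection_mean _ (star_gateRep t e)

theorem exists_cliffordRep_eq_gateRep (t : ℕ) (e : Fin 2 ↪ Fin n) (c : CliffordClass 2) :
    ∃ d, cliffordRep n t d = gateRep t e c := by
  rw [gateRep_apply]
  exact exists_cliffordRep_eq t (gate_mem_cliffordGroup e (rep_mem c))

/-- A two-qubit gate is itself an `n`-qubit Clifford unitary, so the mean over the whole group
absorbs each term of the mean over gates. -/
theorem cliffordProj_mul_gateProj (t : ℕ) (e : Fin 2 ↪ Fin n) :
    cliffordProj n t * gateProj t e = cliffordProj n t := by
  rw [gateProj, mul_mean]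
  conv_rhs => rw [← mean_const (α := CliffordClass 2) (cliffordProj n t)]
  congr 1
  funext c
  obtain ⟨d, hd⟩ := exists_cliffordRep_eq_gateRep t e c
  rw [← hd]
  exact mean_mul_map _ d

theorem gateProj_mul_cliffordProj (t : ℕ) (e : Fin 2 ↪ Fin n) :
    gateProj t e * cliffordProj n t = cliffordProj n t := by
  rw [gateProj, mean_mul]
  conv_rhs => rw [← mean_const (α := CliffordClass 2) (cliffordProj n t)]
  congr 1
  funext c
  obtain ⟨d, hd⟩ := exists_cliffordRep_eq_gateRep t e c
  rw [← hd]
  exact map_mul_mean _ d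

theorem commute_gateProj (t : ℕ) {e e' : Fin 2 ↪ Fin n} (h : ∀ a b, e a ≠ e' b) :
    Commute (gateProj t e) (gateProj t e') := by
  refine commute_mean fun d => (commute_mean fun c => ?_).symm
  have h1 : Commute (gate e c.rep) (gate e' d.rep) :=
    Subtype.ext (commute_gateMatrix_gateMatrix e e' h _ _)
  rw [gateRep_apply, gateRep_apply]
  exact (h1.map (momentRep n t)).symm

theorem continuous_momentKernel_apply (t : ℕ)
    (x y : (Fin t → Basis n) × (Fin t → Basis n)) :
    Continuous fun U : UGroup n => momentKernel (U : Matrix (Basis n) (Basis n) ℂ) t x y := by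
  have h : ∀ a b, Continuous fun U : UGroup n => (U : Matrix (Basis n) (Basis n) ℂ) a b :=
    fun a b => (continuous_apply_apply a b).comp continuous_subtype_val
  simp only [momentKernel, tensorPower, Matrix.kroneckerMap_apply, Matrix.of_apply,
    Matrix.map_apply]
  exact (continuous_finsetProd _ fun k _ => h _ _).mul
    (continuous_finsetProd _ fun k _ => (h _ _).star)

theorem momentOperator_map_uniform {α : Type*} [Fintype α] [Nonempty α] (f : α → UGroup n)
    (t : ℕ) : momentOperator ((PMF.uniformOfFintype α).map f).toMeasure t =
      mean fun a => momentKernel (f a : Matrix (Basis n) (Basis n) ℂ) t := by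
  -- The discrete σ-algebra makes the parametrisation measurable, so the integral can be pulled back
  -- to a finite sum.
  let _ : MeasurableSpace α := ⊤
  ext x y
  have h1 : Measurable f := fun _ _ => trivial
  rw [momentOperator, Matrix.of_apply, ← PMF.toMeasure_map f _ h1,
    integral_map h1.aemeasurable (continuous_momentKernel_apply t x y).aestronglyMeasurable,
    PMF.integral_eq_sum]
  simp [mean, Matrix.sum_apply, Finset.mul_sum]

theorem toEuclideanCLM_mean {α ι : Type*} [Fintype α] [Fintype ι] [DecidableEq ι]
    (f : α → Matrix ι ι ℂ) :
    Matrix.toEuclideanCLM (𝕜 := ℂ) (mean f) = mean fun a => Matrix.toEuclideanCLM (𝕜 := ℂ) (f a) := by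
  rw [mean, mean, map_smul, map_sum]

theorem toEuclideanCLM_uniformClifford (n t : ℕ) :
    Matrix.toEuclideanCLM (𝕜 := ℂ) (momentOperator (uniformClifford n) t) = cliffordProj n t := by
  rw [uniformClifford, momentOperator_map_uniform, toEuclideanCLM_mean, cliffordProj]
  exact congrArg mean (funext fun c =>
    (cliffordLift_apply (momentRep n t) (momentRep_eq_one t) c).symm)

/-- The moment operator of a layer of independent Clifford gates. -/
noncomputable def layerProj (t : ℕ) (hn : 2 ≤ n) (P : Fin n → Prop) :
    MomentSpace n t →L[ℂ] MomentSpace n t :=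
  open Classical in
  (((List.finRange n).filter fun i => P i).map fun i => gateProj t (bond hn i)).prod

theorem toEuclideanCLM_brickworkClifford (hn : 2 ≤ n) (b : Boundary) (t : ℕ) :
    Matrix.toEuclideanCLM (𝕜 := ℂ) (momentOperator (brickworkClifford hn b) t) =
      layerProj t hn (fun i => Odd (i : ℕ) ∧ b.Allows i) *
        layerProj t hn (fun i => Even (i : ℕ) ∧ b.Allows i) := by
  classical
  rw [brickworkClifford, momentOperator_map_uniform, toEuclideanCLM_mean, layerProj, layerProj,
    ← List.prod_append, ← List.map_append]
  simp only [gateProj]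
  rw [← mean_list_prod]
  · congr 1
    funext c
    change momentRep n t (brickworkCircuit hn b fun i => (c i).rep) = _
    rw [brickworkCircuit, map_mul, layer, layer, map_list_prod, map_list_prod, ← List.prod_append,
      List.map_map, List.map_map, ← List.map_append]
    simp only [gateRep_apply]
    rfl
  -- Odd and even sites are disjoint, so the two layers together draw each gate only once, as
  -- independence requires.
  · refine List.Nodup.append ((List.nodup_finRange n).filter _)
      ((List.nodup_finRange n).filter _) ?_
    intro i hi hi'
    simp only [List.mem_filter, decide_eq_true_eq] at hi hi'
    exact (Nat.not_even_iff_odd.2 hi.2.1) hi'.2.1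

end Representation

/-! ### Layers of the brickwork circuit -/

theorem prod_map_filter {α M : Type*} [Monoid M] (l : List α) (P : α → Prop) [DecidablePred P]
    (f : α → M) :
    ((l.filter fun i => P i).map f).prod = (l.map fun i => if P i then f i else 1).prod := by
  induction l with
  | nil => rfl
  | cons i l ih => by_cases h : P i <;> simp [h, ih]

theorem prod_map_range_two_mul {M : Type*} [Monoid M] (G : ℕ → M) {N m : ℕ} (hN : N = 2 * m) :
    ((List.range N).map G).prod =
      ((List.range m).map fun l => G (2 * l) * G (2 * l + 1)).prod := by
  subst hN
  induction m with
  | zero => rfl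
  | succ m ih =>
    rw [show 2 * (m + 1) = 2 * m + 1 + 1 by ring, List.prod_range_succ, List.prod_range_succ, ih,
      List.prod_range_succ, mul_assoc]

/-- An idempotent that commutes with all factors and occurs among them is absorbed by the product.
-/
theorem mul_list_prod_eq {M : Type*} [Monoid M] {p : M} {l : List M}
    (hc : ∀ q ∈ l, Commute p q) (hp : p ∈ l) (hi : p * p = p) : p * l.prod = l.prod := by
  induction l with
  | nil => simp at hp
  | cons q l ih =>
    rw [List.prod_cons]
    by_cases hpl : p ∈ l
    · rw [← mul_assoc, (hc q (by simp)).eq, mul_assoc,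
        ih (fun r hr => hc r (by simp [hr])) hpl]
    · obtain rfl : p = q := by
        rcases List.mem_cons.1 hp with h | h
        · exact h
        · exact absurd h hpl
      rw [← mul_assoc, hi]

theorem list_prod_mul_eq {M : Type*} [Monoid M] {P : M} {l : List M} (h : ∀ q ∈ l, q * P = P) :
    l.prod * P = P := by
  induction l with
  | nil => simp
  | cons q l ih =>
    rw [List.prod_cons, mul_assoc, ih fun r hr => h r (by simp [hr]), h q (by simp)]

theorem mul_list_prod_eq_left {M : Type*} [Monoid M] {P : M} {l : List M}
    (h : ∀ q ∈ l, P * q = P) : P * l.prod = P := by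
  induction l with
  | nil => simp
  | cons q l ih =>
    rw [List.prod_cons, ← mul_assoc, h q (by simp), ih fun r hr => h r (by simp [hr])]

section Layers

variable {n : ℕ}

/-- The projection onto the invariants of the Clifford group on the qubits `i, i + 1`. -/
noncomputable def bondProj (t : ℕ) (hn : 2 ≤ n) (i : ℕ) : MomentSpace n t →L[ℂ] MomentSpace n t :=
  -- The value 1 out of range is also a projection absorbed by `cliffordProj`, so the basic
  -- identities hold for all natural indices.
  if h : i < n then gateProj t (bond hn ⟨i, h⟩) else 1

variable (t : ℕ) (hn : 2 ≤ n)

theorem bondProj_coe (i : Fin n) : bondProj t hn i = gateProj t (bond hn i) := dif_pos i.2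

theorem isStarProjection_bondProj (i : ℕ) : IsStarProjection (bondProj t hn i) := by
  rw [bondProj]
  split_ifs
  · exact isStarProjection_gateProj t _
  · exact IsStarProjection.one _

theorem bondProj_mul_self (i : ℕ) : bondProj t hn i * bondProj t hn i = bondProj t hn i :=
  (isStarProjection_bondProj t hn i).isIdempotentElem

theorem bondProj_mul_cliffordProj (i : ℕ) :
    bondProj t hn i * cliffordProj n t = cliffordProj n t := by
  rw [bondProj]
  split_ifs
  · exact gateProj_mul_cliffordProj t _
  · exact one_mul _

theorem cliffordProj_mul_bondProj (i : ℕ) :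
    cliffordProj n t * bondProj t hn i = cliffordProj n t := by
  rw [bondProj]
  split_ifs
  · exact cliffordProj_mul_gateProj t _
  · exact mul_one _

theorem commute_bondProj_of_disjoint {i j : ℕ} (hi : i < n) (hj : j < n)
    (h : i ≠ j ∧ i ≠ (j + 1) % n ∧ (i + 1) % n ≠ j ∧ (i + 1) % n ≠ (j + 1) % n) :
    Commute (bondProj t hn i) (bondProj t hn j) := by
  rw [bondProj, bondProj, dif_pos hi, dif_pos hj]
  refine commute_gateProj t ?_
  intro a b hab
  have hab' := congrArg Fin.val hab
  fin_cases a <;> fin_cases b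
  · exact h.1 hab'
  · exact h.2.1 hab'
  · exact h.2.2.1 hab'
  · exact h.2.2.2 hab'

theorem commute_bondProj {i j : ℕ} (hij : i + 1 < j) (hj : j + 1 < n) :
    Commute (bondProj t hn i) (bondProj t hn j) := by
  refine commute_bondProj_of_disjoint t hn (by omega) (by omega) ?_
  rw [Nat.mod_eq_of_lt hj, Nat.mod_eq_of_lt (by omega)]
  omega

theorem layerProj_eq (P : Fin n → Prop) (Q : ℕ → Prop) [DecidablePred Q]
    (hPQ : ∀ i : Fin n, P i ↔ Q i) :
    layerProj t hn P =
      ((List.range n).map fun i => if Q i then bondProj t hn i else 1).prod := by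
  classical
  rw [layerProj, prod_map_filter]
  have h1 : List.range n = (List.finRange n).map Fin.val := by simp
  rw [h1, List.map_map]
  congr 1
  refine List.map_congr_left fun i _ => ?_
  simp only [Function.comp_apply, hPQ, bondProj_coe]

variable {m : ℕ}

theorem layerProj_even (hm : n = 2 * m) (b : Boundary) :
    layerProj t hn (fun i => Even (i : ℕ) ∧ b.Allows i) =
      ((List.range m).map fun l => bondProj t hn (2 * l)).prod := by
  rw [layerProj_eq t hn _ (fun i => Even i)]
  · rw [prod_map_range_two_mul _ hm]
    congr 1
    exact List.map_congr_left fun l _ => by simp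
  · intro i
    refine and_iff_left_of_imp fun h => ?_
    cases b with
    | opened =>
      change (i : ℕ) + 1 < n
      obtain ⟨k, hk⟩ := h
      have := i.2
      omega
    | periodic => trivial

theorem layerProj_odd_opened (hm : n = 2 * m) :
    layerProj t hn (fun i => Odd (i : ℕ) ∧ Boundary.opened.Allows i) =
      ((List.range m).map fun l =>
        if 2 * l + 2 < n then bondProj t hn (2 * l + 1) else 1).prod := by
  rw [layerProj_eq t hn (fun i => Odd (i : ℕ) ∧ Boundary.opened.Allows i)
    (fun i => Odd i ∧ i + 1 < n) fun _ => Iff.rfl]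
  rw [prod_map_range_two_mul _ hm]
  congr 1
  refine List.map_congr_left fun l _ => ?_
  have h1 : ¬Odd (2 * l) := by simp
  have h2 : Odd (2 * l + 1) := by simp
  simp only [h1, h2, false_and, true_and, if_false, one_mul]

theorem layerProj_odd_periodic (hm : n = 2 * m) :
    layerProj t hn (fun i => Odd (i : ℕ) ∧ Boundary.periodic.Allows i) =
      ((List.range m).map fun l => bondProj t hn (2 * l + 1)).prod := by
  rw [layerProj_eq t hn (fun i => Odd (i : ℕ) ∧ Boundary.periodic.Allows i) (fun i => Odd i)
    fun _ => and_iff_left trivial]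
  rw [prod_map_range_two_mul _ hm]
  congr 1
  exact List.map_congr_left fun l _ => by simp

/-- The gate across the boundary is disjoint from the other odd bonds, so its projection can be
moved from the end of the product to the front. -/
theorem layerProj_odd_periodic_eq_mul (hm : n = 2 * m) :
    layerProj t hn (fun i => Odd (i : ℕ) ∧ Boundary.periodic.Allows i) =
      bondProj t hn (n - 1) *
        layerProj t hn (fun i => Odd (i : ℕ) ∧ Boundary.opened.Allows i) := by
  rw [layerProj_odd_periodic t hn hm, layerProj_odd_opened t hn hm]
  obtain ⟨k, rfl⟩ : ∃ k, m = k + 1 := ⟨m - 1, by omega⟩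
  rw [List.prod_range_succ, List.prod_range_succ, if_neg (by omega), mul_one,
    show n - 1 = 2 * k + 1 by omega]
  have h1 : (List.range k).map (fun l =>
      if 2 * l + 2 < n then bondProj t hn (2 * l + 1) else 1) =
      (List.range k).map fun l => bondProj t hn (2 * l + 1) :=
    List.map_congr_left fun l hl => if_pos (by have := List.mem_range.1 hl; omega)
  rw [h1]
  refine (Commute.list_prod_right _ _ ?_).eq.symm
  simp only [List.mem_map, List.mem_range]
  rintro _ ⟨l, hl, rfl⟩
  refine commute_bondProj_of_disjoint t hn (by omega) (by omega) ?_
  rw [show 2 * k + 1 + 1 = n by omega, Nat.mod_self, Nat.mod_eq_of_lt (by omega)]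
  omega

end Layers

/-! ### The spectral gap -/

section Gap

variable {n m : ℕ} (t : ℕ) (hn : 2 ≤ n)

/-- Moving a vector by Clifford unitaries defines a length with weights `2 ‖φ - P_i φ‖`. -/
theorem isGateLength_norm_sub (φ : MomentSpace n t) :
    IsGateLength hn (fun i => 2 * ‖φ - bondProj t hn i φ‖) fun U => ‖φ - momentRep n t U φ‖ where
  mul_le U V := by
    have h1 : φ - momentRep n t (U * V) φ =
        (φ - momentRep n t U φ) + momentRep n t U (φ - momentRep n t V φ) := by
      rw [map_mul, map_sub]
      change φ - momentRep n t U (momentRep n t V φ) = _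
      abel
    rw [h1]
    refine (norm_add_le _ _).trans (add_le_add le_rfl ?_)
    rw [norm_apply_eq_of_star_eq_inv _ (star_momentRep t)]
  inv_le U := by
    have h1 : momentRep n t U⁻¹ (momentRep n t U φ) = φ := by
      change (momentRep n t U⁻¹ * momentRep n t U) φ = φ
      rw [← map_mul, inv_mul_cancel, map_one]
      rfl
    have h2 : φ - momentRep n t U⁻¹ φ = -momentRep n t U⁻¹ (φ - momentRep n t U φ) := by
      rw [map_sub, h1]
      abel
    rw [h2, norm_neg, norm_apply_eq_of_star_eq_inv _ (star_momentRep t)]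
  scalar_le U hU := by
    rw [momentRep_eq_one t U hU]
    simp
  gate_le i hi V hV := by
    have h1 := norm_sub_map_apply_le (gateRep t (bond hn i)) (star_gateRep t _)
      ((⟨V, hV⟩ : cliffordGroup 2) : CliffordClass 2) φ
    rw [bondProj_coe]
    exact h1
  weight_nonneg i := by positivity

/-- An open chain of even length has its first and last bonds, `0` and `N - 2`, both even; without
weight on the odd bonds, `m` terms remain. -/
theorem sum_range_sub_one_eq (w : ℕ → ℝ) {N m : ℕ} (hN : N = 2 * m) (hm : 0 < m)
    (hodd : ∀ l, l + 1 < m → w (2 * l + 1) = 0) :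
    ∑ j ∈ Finset.range (N - 1), w j = ∑ l ∈ Finset.range m, w (2 * l) := by
  subst hN
  induction m, hm using Nat.le_induction with
  | base => simp
  | succ m hm ih =>
    rw [Finset.sum_range_succ _ m, ← ih fun l hl => hodd l (by omega),
      show 2 * (m + 1) - 1 = (2 * m - 1) + 1 + 1 by omega, Finset.sum_range_succ,
      Finset.sum_range_succ, show 2 * m - 1 + 1 = 2 * m by omega,
      show 2 * m - 1 = 2 * (m - 1) + 1 by omega, hodd (m - 1) (by omega), add_zero]

theorem le_one_sub_mul_of_sq_le {x y N : ℝ} (hy : 0 ≤ y) (hN : 1 ≤ N)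
    (h : x ^ 2 ≤ 256 * N * (y ^ 2 - x ^ 2)) : x ≤ (1 - 1 / (2000 * N)) * y := by
  have h1 : 1 / (2000 * N) ≤ 1 := by
    rw [div_le_one (by positivity)]
    linarith
  refine le_of_sq_le_sq ?_ (mul_nonneg (by linarith) hy)
  have h2 : x ^ 2 ≤ (1 - 1 / (1000 * N)) * y ^ 2 := by
    have h3 : (1 + 256 * N) * x ^ 2 ≤ (1 + 256 * N) * ((1 - 1 / (1000 * N)) * y ^ 2) := by
      have h4 : (1 + 256 * N) * (1 - 1 / (1000 * N)) =
          256 * N + (1 - 256 / 1000 - 1 / (1000 * N)) := by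
        field_simp
        ring
      have h5 : 1 / (1000 * N) ≤ 1 / 1000 := by
        refine one_div_le_one_div_of_le (by norm_num) (by linarith)
      rw [← mul_assoc, h4]
      nlinarith [sq_nonneg y]
    exact le_of_mul_le_mul_left h3 (by positivity)
  refine h2.trans ?_
  rw [mul_pow]
  refine mul_le_mul_of_nonneg_right ?_ (sq_nonneg y)
  have h6 : 1 / (1000 * N) = 2 * (1 / (2000 * N)) := by
    field_simp
    norm_num
  rw [h6]
  nlinarith [sq_nonneg (1 / (2000 * N))]

theorem norm_opened_sub_apply_le (hm : n = 2 * m) (v : MomentSpace n t) :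
    ‖(layerProj t hn (fun i => Odd (i : ℕ) ∧ Boundary.opened.Allows i) *
        layerProj t hn (fun i => Even (i : ℕ) ∧ Boundary.opened.Allows i) - cliffordProj n t) v‖ ≤
      (1 - 1 / (2000 * (n : ℝ) ^ 3)) * ‖v‖ := by
  set p := bondProj t hn with hp
  set P := cliffordProj n t with hP
  rw [layerProj_even t hn hm, layerProj_odd_opened t hn hm]
  -- The odd projections are shifted by one and padded with 1 at `k = 0` and `k = m`. Every even
  -- bond `2 l` then lies between `o l` and `o (l + 1)`, the only factors it may fail to commute
  -- with, as the detectability lemma requires.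
  set o : ℕ → MomentSpace n t →L[ℂ] MomentSpace n t := fun k =>
    if 0 < k ∧ 2 * k < n then p (2 * k - 1) else 1 with ho
  have hoB : ((List.range m).map fun l => if 2 * l + 2 < n then p (2 * l + 1) else 1).prod =
      ((List.range (m + 1)).map o).prod := by
    rw [List.prod_range_succ']
    have h0 : o 0 = 1 := by simp [ho]
    rw [h0, one_mul]
    congr 1
    refine List.map_congr_left fun l _ => ?_
    simp only [ho, Nat.succ_eq_add_one, Nat.succ_pos, true_and, Nat.mul_add, Nat.mul_one]
    rfl
  rw [hoB]
  set A := ((List.range m).map fun l => p (2 * l)).prod with hA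
  set B := ((List.range (m + 1)).map o).prod with hB
  have hpcomm : ∀ i j, i + 1 < j → j + 1 < n → Commute (p i) (p j) :=
    fun i j => commute_bondProj t hn
  have hopcomm : ∀ j, j + 1 < n → ∀ k, j ≠ 2 * k → j + 2 ≠ 2 * k → Commute (p j) (o k) := by
    intro j hj k h1 h2
    simp only [ho]
    split_ifs with hk
    · rcases lt_trichotomy j (2 * k - 1) with h3 | h3 | h3
      · exact hpcomm _ _ (by omega) (by omega)
      · rw [h3]
      · exact (hpcomm _ _ (by omega) (by omega)).symm
    · exact Commute.one_right _
  have hoo : ∀ j k, Commute (o j) (o k) := by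
    intro j k
    by_cases hj : 0 < j ∧ 2 * j < n
    · have h1 : o j = p (2 * j - 1) := if_pos hj
      rw [h1]
      exact hopcomm _ (by omega) _ (by omega) (by omega)
    · have h1 : o j = 1 := if_neg hj
      rw [h1]
      exact Commute.one_left _
  have hostar : ∀ k, IsStarProjection (o k) := by
    intro k
    simp only [ho]
    split_ifs
    · exact isStarProjection_bondProj t hn _
    · exact IsStarProjection.one _
  have hoP : ∀ k, o k * P = P ∧ P * o k = P := by
    intro k
    simp only [ho]
    split_ifs
    · exact ⟨bondProj_mul_cliffordProj t hn _, cliffordProj_mul_bondProj t hn _⟩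
    · exact ⟨one_mul _, mul_one _⟩
  have hacomm : ∀ j < m, ∀ l < m, Commute (p (2 * j)) (p (2 * l)) := by
    intro j hj l hl
    rcases lt_trichotomy j l with h | h | h
    · exact hpcomm _ _ (by omega) (by omega)
    · rw [h]
    · exact (hpcomm _ _ (by omega) (by omega)).symm
  have hAmem : ∀ q ∈ (List.range m).map (fun l => p (2 * l)), ∃ l < m, p (2 * l) = q := by
    intro q hq
    obtain ⟨l, hl, rfl⟩ := List.mem_map.1 hq
    exact ⟨l, List.mem_range.1 hl, rfl⟩
  have hAstar : IsStarProjection A := by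
    refine isStarProjection_list_prod _ (fun q hq => ?_) fun q hq r hr => ?_
    · obtain ⟨l, -, rfl⟩ := hAmem q hq
      exact isStarProjection_bondProj t hn _
    · obtain ⟨j, hj, rfl⟩ := hAmem q hq
      obtain ⟨l, hl, rfl⟩ := hAmem r hr
      exact hacomm j hj l hl
  have haA : ∀ l < m, p (2 * l) * A = A := by
    intro l hl
    refine mul_list_prod_eq (fun q hq => ?_) (List.mem_map.2 ⟨l, List.mem_range.2 hl, rfl⟩)
      (bondProj_mul_self t hn _)
    obtain ⟨j, hj, rfl⟩ := hAmem q hq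
    exact hacomm l hl j hj
  have hAP : A * P = P := list_prod_mul_eq fun q hq => by
    obtain ⟨l, -, rfl⟩ := hAmem q hq
    exact bondProj_mul_cliffordProj t hn _
  have hPA : P * A = P := mul_list_prod_eq_left fun q hq => by
    obtain ⟨l, -, rfl⟩ := hAmem q hq
    exact cliffordProj_mul_bondProj t hn _
  have hBP : B * P = P := list_prod_mul_eq fun q hq => by
    obtain ⟨k, -, rfl⟩ := List.mem_map.1 hq
    exact (hoP k).1
  have hPB : P * B = P := mul_list_prod_eq_left fun q hq => by
    obtain ⟨k, -, rfl⟩ := List.mem_map.1 hq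
    exact (hoP k).2
  have hPP : P * P = P := (isStarProjection_cliffordProj n t).isIdempotentElem
  -- the vector after the first layer, with the invariant part removed
  set w : MomentSpace n t := (A - P) v with hw
  have haw : ∀ l < m, p (2 * l) w = w := by
    intro l hl
    change (p (2 * l) * (A - P)) v = _
    rw [mul_sub, haA l hl, bondProj_mul_cliffordProj]
  have hBw : B w = (B * A - P) v := by
    change (B * (A - P)) v = _
    rw [mul_sub, hBP]
  have hPφ : P (B w) = 0 := by
    change (P * (B * (A - P))) v = 0
    rw [← mul_assoc, hPB, mul_sub, hPA, hPP, sub_self]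
    rfl
  have hwv : ‖w‖ ≤ ‖v‖ := by
    have h1 : w = A ((1 - P) v) := by
      change _ = (A * (1 - P)) v
      rw [mul_sub, mul_one, hAP]
    rw [h1]
    exact (norm_apply_le_of_isStarProjection hAstar _).trans
      (norm_apply_le_of_isStarProjection (isStarProjection_cliffordProj n t).one_sub _)
  rw [← hBw]
  set φ := B w with hφ
  have hdet := sum_norm_sub_apply_sq_le m (fun l => p (2 * l)) o hostar
    (fun l _ => isStarProjection_bondProj t hn _) hoo
    (fun l hl k h1 h2 => hopcomm _ (by omega) k (by omega) (by omega)) w haw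
  rw [← hB, ← hφ] at hdet
  -- `φ` lies in the range of `B`, which absorbs each odd projection, so odd bonds cost nothing in
  -- the length estimate.
  have hoddφ : ∀ l, l + 1 < m → 2 * ‖φ - p (2 * l + 1) φ‖ = 0 := by
    intro l hl
    have h1 : o (l + 1) = p (2 * l + 1) := if_pos ⟨by omega, by omega⟩
    have h2 : o (l + 1) * B = B := by
      refine mul_list_prod_eq (fun q hq => ?_)
        (List.mem_map.2 ⟨l + 1, List.mem_range.2 (by omega), rfl⟩)
        (hostar _).isIdempotentElem
      obtain ⟨k, -, rfl⟩ := List.mem_map.1 hq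
      exact hoo _ _
    have h3 : p (2 * l + 1) φ = φ := by
      rw [← h1]
      exact congrArg (fun q : MomentSpace n t →L[ℂ] MomentSpace n t => q w) h2
    rw [h3, sub_self, norm_zero, mul_zero]
  have hlen := isGateLength_norm_sub t hn φ
  have hsum : ∑ j ∈ Finset.range (n - 1), 2 * ‖φ - p j φ‖ =
      ∑ l ∈ Finset.range m, 2 * ‖φ - p (2 * l) φ‖ := by
    exact sum_range_sub_one_eq (fun j => 2 * ‖φ - p j φ‖) hm (by omega) hoddφ
  set T := ∑ l ∈ Finset.range m, ‖φ - p (2 * l) φ‖ with hT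
  -- The 16 is 8 uses per bond and qubit times the 2 in the weight `2 ‖φ - p j φ‖`.
  have hφT : ‖φ‖ ≤ 16 * n * T := by
    have h1 : 16 * n * T = 8 * n * ∑ j ∈ Finset.range (n - 1), 2 * ‖φ - p j φ‖ := by
      rw [hsum, ← Finset.mul_sum]
      ring
    rw [h1]
    refine norm_le_of_mean_apply_eq_zero (cliffordRep n t) hPφ fun c => ?_
    have h2 := hlen.le_of_mem (rep_mem c)
    rwa [← cliffordLift_apply (momentRep n t) (momentRep_eq_one t)] at h2
  -- Cauchy–Schwarz over the `m` even bonds contributes `m`, the detectability lemma contributes 2,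
  -- and `2 m = n`.
  have hT2 : T ^ 2 ≤ n * (‖v‖ ^ 2 - ‖φ‖ ^ 2) := by
    have h1 : T ^ 2 ≤ m * ∑ l ∈ Finset.range m, ‖φ - p (2 * l) φ‖ ^ 2 := by
      simpa using sq_sum_le_card_mul_sum_sq (s := Finset.range m)
        (f := fun l => ‖φ - p (2 * l) φ‖)
    have h2 : (n : ℝ) = 2 * m := by exact_mod_cast hm
    have h3 : ‖w‖ ^ 2 ≤ ‖v‖ ^ 2 := by gcongr
    calc T ^ 2 ≤ m * (2 * (‖w‖ ^ 2 - ‖φ‖ ^ 2)) := h1.trans (by gcongr)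
      _ ≤ m * (2 * (‖v‖ ^ 2 - ‖φ‖ ^ 2)) := by gcongr
      _ = n * (‖v‖ ^ 2 - ‖φ‖ ^ 2) := by rw [h2]; ring
  have hn1 : (1 : ℝ) ≤ n := by exact_mod_cast (by omega : 1 ≤ n)
  refine le_one_sub_mul_of_sq_le (norm_nonneg v) (one_le_pow₀ hn1) ?_
  calc ‖φ‖ ^ 2 ≤ (16 * n * T) ^ 2 := by gcongr
    _ = 256 * n ^ 2 * T ^ 2 := by ring
    _ ≤ 256 * n ^ 2 * (n * (‖v‖ ^ 2 - ‖φ‖ ^ 2)) := by gcongr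
    _ = 256 * n ^ 3 * (‖v‖ ^ 2 - ‖φ‖ ^ 2) := by ring

theorem norm_brickwork_sub_apply_le (hm : n = 2 * m) (b : Boundary) (v : MomentSpace n t) :
    ‖(layerProj t hn (fun i => Odd (i : ℕ) ∧ b.Allows i) *
        layerProj t hn (fun i => Even (i : ℕ) ∧ b.Allows i) - cliffordProj n t) v‖ ≤
      (1 - 1 / (2000 * (n : ℝ) ^ 3)) * ‖v‖ := by
  cases b with
  | opened => exact norm_opened_sub_apply_le t hn hm v
  | periodic =>
    have h1 := norm_opened_sub_apply_le t hn hm v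
    rw [layerProj_even t hn hm] at h1 ⊢
    rw [layerProj_odd_periodic_eq_mul t hn hm]
    refine le_trans ?_ h1
    -- The projection across the boundary also fixes the Clifford invariants, so it factors out of
    -- the whole difference and can only shorten the vector.
    conv_lhs => rw [← bondProj_mul_cliffordProj t hn (n - 1), mul_assoc, ← mul_sub]
    exact norm_apply_le_of_isStarProjection (isStarProjection_bondProj t hn _) _

end Gap

end CliffordBrickwork

/-- For an even number `n` of qubits, both boundary conditions and all `t ≥ 1`,
`‖M(ν_n^{Cl,bw}, t) - M(μ_Cl, t)‖_∞ ≤ 1 - 1 / (2000 n³)`. -/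
theorem lemma6 (n : ℕ) (hn : 2 ≤ n) (hne : Even n) (b : CliffordBrickwork.Boundary)
    (t : ℕ) (ht : 1 ≤ t) :
    CliffordBrickwork.opNorm
      (CliffordBrickwork.momentOperator (CliffordBrickwork.brickworkClifford hn b) t -
        CliffordBrickwork.momentOperator (CliffordBrickwork.uniformClifford n) t) ≤
      1 - 1 / (2000 * (n : ℝ) ^ 3) := by
  obtain ⟨m, hm⟩ := hne
  have hn1 : (1 : ℝ) ≤ n := by exact_mod_cast (by omega : 1 ≤ n)
  have hn3 : (1 : ℝ) ≤ (n : ℝ) ^ 3 := one_le_pow₀ hn1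
  have h1 : 1 / (2000 * (n : ℝ) ^ 3) ≤ 1 := by
    rw [div_le_one (by positivity)]
    linarith
  rw [CliffordBrickwork.opNorm, map_sub, CliffordBrickwork.toEuclideanCLM_brickworkClifford,
    CliffordBrickwork.toEuclideanCLM_uniformClifford]
  exact ContinuousLinearMap.opNorm_le_bound _ (by linarith) fun v =>
    CliffordBrickwork.norm_brickwork_sub_apply_le t hn (m := m) (by omega) b v
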